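/- Let $\Phi_e$ denote the $e$-th Turing functional (partial computable function) on $\mathbb N^{\mathbb N}$ in a standard effective enumeration, and write $g\restriction n$ for the initial segment of $g$ of length $n$. A set $P\subseteq 2^{\mathbb N}$ is $\Pi^0_1$ if $P=\{f\in 2^{\mathbb N}:\Phi_e(f;0)\text{ diverges}\}$ for some $e$. A learner is a total computable function $\Psi:\mathbb N^{<\mathbb N}\to\mathbb N$; it identifies a partial function $\Gamma:\subseteq\mathbb N^{\mathbb N}\to\mathbb N^{\mathbb N}$ on $g\in\mathrm{dom}(\Gamma)$ if $e=\lim_n\Psi(g\restriction n)$ exists and $\Phi_e(g)=\Gamma(g)$. The partial function $\Gamma$ is * $(1,\omega)$-computable if a single learner identifies $\Gamma$ on every $g\in\mathrm{dom}(\Gamma)$; * $(<\omega,1)$-computable if there is $b\in\mathbb N$ such that for every $g\in\mathrm{dom}(\Gamma)$ there is $e<b$ with $\Gamma(g)=\Phi_e(g)$; * $(<\omega,\omega)$-computable if there is a finite family of learners such that for every $g\in\mathrm{dom}(\Gamma)$ some learner of the family identifies $\Gamma$ on $g$. For $P,Q\subseteq\mathbb N^{\mathbb N}$, write $P\le^\alpha_\beta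 Q$ if there is an $(\alpha,\beta)$-computable $\Gamma$ with $Q\subseteq\mathrm{dom}(\Gamma)$ and $\Gamma(g)\in P$ for every $g\in Q$; write $P\equiv^\alpha_\beta Q$ if $P\le^\alpha_\beta Q$ and $Q\le^\alpha_\beta P$; and write $P<^\alpha_\beta Q$ if $P\le^\alpha_\beta Q$ and $Q\not\le^\alpha_\beta P$. 1. There exist $\Pi^0_1$ sets $P,Q\subseteq 2^{\mathbb N}$ such that $P\equiv^{<\omega}_1 Q$ but $Q\not\le^1_\omega P$. 2. There exist $\Pi^0_1$ sets $P,Q\subseteq 2^{\mathbb N}$ such that $P\equiv^{<\omega}_\omega Q$ but $P<^1_\omega Q$. -/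

import Mathlib

/-- The initial segment `f ↾ s = ⟨f 0, …, f (s - 1)⟩` of `f ∈ ℕ^ℕ`. -/
def initSeg (f : ℕ → ℕ) (s : ℕ) : List ℕ := (List.range s).map f

/-- `Φ_e(f; n)`: the value at `n` of the `e`-th Turing functional with oracle `f`.
The `e`-th partial recursive function is used as an oracle procedure that sees a finite part
`f ↾ s` of its oracle and the argument `n`; all lengths `s` and numbers of steps `t` are tried,
in the order of the pair `⟨t, s⟩`, and the first value that is found is the output
(no value if nothing is ever found).
The argument `(f ↾ s, n)` is passed as its numerical code. -/
def turingFunctional (e : ℕ) (f : ℕ → ℕ) (n : ℕ) : Part ℕ :=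
  Nat.rfindOpt fun k : ℕ =>
    Nat.Partrec.Code.evaln k.unpair.1 (Denumerable.ofNat Nat.Partrec.Code e)
      (Encodable.encode (initSeg f k.unpair.2, n))

/-- `Φ_e(f; n)` converges iff the `e`-th procedure halts on some finite part of the oracle. -/
theorem turingFunctional_dom (e : ℕ) (f : ℕ → ℕ) (n : ℕ) :
    (turingFunctional e f n).Dom ↔
      ∃ s : ℕ, ((Denumerable.ofNat Nat.Partrec.Code e).eval
        (Encodable.encode (initSeg f s, n))).Dom := by
  unfold turingFunctional
  rw [Nat.rfindOpt_dom]
  constructor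
  · rintro ⟨k, a, h⟩
    exact ⟨k.unpair.2, Part.dom_iff_mem.2 ⟨a, Nat.Partrec.Code.evaln_sound h⟩⟩
  · rintro ⟨s, h⟩
    obtain ⟨a, ha⟩ := Part.dom_iff_mem.1 h
    obtain ⟨t, ht⟩ := Nat.Partrec.Code.evaln_complete.1 ha
    exact ⟨Nat.pair t s, a, by simpa using ht⟩

/-- Every partial recursive assignment of values to finite parts of oracles whose values never
conflict along an oracle is one of the Turing functionals, uniformly in the oracle. -/
theorem exists_turingFunctional (F : List ℕ → ℕ →. ℕ) (hF : Partrec₂ F) :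
    ∃ e : ℕ, ∀ (f : ℕ → ℕ) (n : ℕ),
      (∀ s t a b : ℕ, a ∈ F (initSeg f s) n → b ∈ F (initSeg f t) n → a = b) →
        ∀ m : ℕ, m ∈ turingFunctional e f n ↔ ∃ s : ℕ, m ∈ F (initSeg f s) n := by
  obtain ⟨c, hc⟩ := Nat.Partrec.Code.exists_code.1 hF
  have key : ∀ (σ : List ℕ) (n : ℕ), c.eval (Encodable.encode (σ, n)) = F σ n := by
    intro σ n
    simp only [hc, Encodable.encodek, Encodable.encode_nat, Part.map_id', Part.coe_some,
      Part.bind_some, implies_true]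
  refine ⟨Encodable.encode c, fun f n hcons m => ?_⟩
  have sound : ∀ a, a ∈ turingFunctional (Encodable.encode c) f n →
      ∃ s, a ∈ F (initSeg f s) n := by
    intro a ha
    obtain ⟨k, hk⟩ := Nat.rfindOpt_spec ha
    refine ⟨k.unpair.2, ?_⟩
    rw [← key]
    simpa using Nat.Partrec.Code.evaln_sound hk
  refine ⟨sound m, fun ⟨s, hs⟩ => ?_⟩
  have hd : (turingFunctional (Encodable.encode c) f n).Dom := by
    rw [turingFunctional_dom]
    refine ⟨s, ?_⟩
    rw [Denumerable.ofNat_encode, key]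
    exact Part.dom_iff_mem.2 ⟨m, hs⟩
  obtain ⟨a, ha⟩ := Part.dom_iff_mem.1 hd
  obtain ⟨t, ht⟩ := sound a ha
  rwa [hcons s t m a hs ht]

/-- `Φ_e(g) = h`: the `e`-th Turing functional is total on the oracle `g` and its output is `h`. -/
def Computes (e : ℕ) (g h : ℕ → ℕ) : Prop :=
  ∀ n : ℕ, h n ∈ turingFunctional e g n

/-- `P` is a `Π⁰₁` subset of Cantor space `2^ℕ ⊆ ℕ^ℕ`: for some `e`, the set `P` consists of all
`f ∈ 2^ℕ` for which `Φ_e(f; 0)` diverges. -/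
def IsPi01Cantor (P : Set (ℕ → ℕ)) : Prop :=
  ∃ e : ℕ, P = {f : ℕ → ℕ | (∀ n : ℕ, f n < 2) ∧ ¬ (turingFunctional e f 0).Dom}

/-- The partial function `Γ` is identified by the learner `Ψ` on `g`: the guesses `Ψ (g ↾ n)`
converge to some index `e`, and `Φ_e(g) = Γ(g)`. -/
def IdentifiedOn (Γ : (ℕ → ℕ) →. (ℕ → ℕ)) (Ψ : List ℕ → ℕ) (g : ℕ → ℕ) : Prop :=
  ∃ e : ℕ, (∃ N : ℕ, ∀ n : ℕ, N ≤ n → Ψ (initSeg g n) = e) ∧ ∃ h ∈ Γ g, Computes e g h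

/-- The `(1,ω)`-computable (learnable) partial functions on `ℕ^ℕ`. -/
def learnable : Set ((ℕ → ℕ) →. (ℕ → ℕ)) :=
  {Γ | ∃ Ψ : List ℕ → ℕ, Computable Ψ ∧ ∀ g ∈ Γ.Dom, IdentifiedOn Γ Ψ g}

/-- The `(<ω,1)`-computable partial functions on `ℕ^ℕ`: finitely many Turing functionals suffice
(`k`-wise computable for some `k`). -/
def finitelyComputable : Set ((ℕ → ℕ) →. (ℕ → ℕ)) :=
  {Γ | ∃ b : ℕ, ∀ g ∈ Γ.Dom, ∃ e < b, ∃ h ∈ Γ g, Computes e g h}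

/-- The `(<ω,ω)`-computable partial functions on `ℕ^ℕ`: learnable by a finite team of learners. -/
def teamLearnable : Set ((ℕ → ℕ) →. (ℕ → ℕ)) :=
  {Γ | ∃ (b : ℕ) (Ψ : Fin b → List ℕ → ℕ), (∀ i, Computable (Ψ i)) ∧
    ∀ g ∈ Γ.Dom, ∃ i, IdentifiedOn Γ (Ψ i) g}

/-- `P ≤_𝓕 Q`: some partial function in `𝓕` is defined on all of `Q` and maps `Q` into `P`. -/
def ReducibleVia (𝓕 : Set ((ℕ → ℕ) →. (ℕ → ℕ))) (P Q : Set (ℕ → ℕ)) : Prop :=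
  ∃ Γ ∈ 𝓕, ∀ g ∈ Q, ∃ h ∈ Γ g, h ∈ P

/-- `P ≡_𝓕 Q`. -/
def EquivVia (𝓕 : Set ((ℕ → ℕ) →. (ℕ → ℕ))) (P Q : Set (ℕ → ℕ)) : Prop :=
  ReducibleVia 𝓕 P Q ∧ ReducibleVia 𝓕 Q P

/-- `P <_𝓕 Q`. -/
def StrictlyBelowVia (𝓕 : Set ((ℕ → ℕ) →. (ℕ → ℕ))) (P Q : Set (ℕ → ℕ)) : Prop :=
  ReducibleVia 𝓕 P Q ∧ ¬ ReducibleVia 𝓕 Q P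

/-! ### Initial segments -/

/-! One pair of classes settles both parts. An infinite binary sequence is read as pairs, each
writing one bit on tape 0 or tape 1. In `twoTape` the contents of tape `i` must be compatible with
`blockClass i`; `oneTape` is the subclass that never switches tapes. The identity reduces `twoTape`
to `oneTape`. Conversely, a member of `twoTape` has at least one infinite tape, and copying that
tape gives a member of `oneTape`, so two functionals suffice. What cannot be learned is which tape
to copy.

This rests on a strong incomparability, `not_forall_computes_blockClass`: no functional maps a
nonempty relatively open part of `blockClass i` into `blockClass (1 - i)`. Blocks `[4 ^ k, 4 ^ (k +
1))` of parity `1 - i` are unrestricted in class `i` and serve to diagonalise. Each `σ` of length `4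
^ k` forbids at most one value of block `k`, the first one found to be produced from a substantial
fraction of the extensions of `σ`. Only `2 ^ 4 ^ k` of the `2 ^ (3 * 4 ^ k)` possible values are
lost, so almost all extensions of an allowed `σ` stay in class `i`. By compactness and the
pigeonhole principle some value is frequent. The first frequent value is then output on some member
of class `i` above `σ`, although it is forbidden in class `1 - i`.

Suppose now that a learner reduces `oneTape` to `twoTape`. It must convert along every member of
`twoTape`, so some finite condition locks its guess `e` (`exists_locks`); otherwise infinitely many
mind changes could be built into one member. Above that condition, continue on tape 0: by
incomparability the output cannot always declare tape 1, so some continuation makes `Φ_e` declare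
tape 0. This uses finitely many bits. Keep them and switch to tape 1: the output still declares tape
0 but is computed from members of `blockClass 1`, against incomparability again. -/

@[simp] theorem length_initSeg (f : ℕ → ℕ) (s : ℕ) : (initSeg f s).length = s := by
  simp [initSeg]

theorem initSeg_succ (f : ℕ → ℕ) (s : ℕ) : initSeg f (s + 1) = initSeg f s ++ [f s] := by
  simp [initSeg, List.range_succ]

theorem take_initSeg (f : ℕ → ℕ) {s t : ℕ} (h : s ≤ t) :
    (initSeg f t).take s = initSeg f s := by
  simp [initSeg, ← List.map_take, List.take_range, h]

theorem initSeg_congr {f g : ℕ → ℕ} {s : ℕ} (h : ∀ n < s, f n = g n) :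
    initSeg f s = initSeg g s :=
  List.map_congr_left fun n hn => h n (List.mem_range.1 hn)

theorem getD_initSeg (f : ℕ → ℕ) {s n : ℕ} (h : n < s) : (initSeg f s).getD n 0 = f n := by
  simp [initSeg, h]

theorem initSeg_getD (τ : List ℕ) : initSeg (fun n => τ.getD n 0) τ.length = τ := by
  apply List.ext_getElem
  · simp
  · intro n h₁ h₂
    simp [initSeg, h₂]

theorem forall_mem_initSeg {f : ℕ → ℕ} (hf : ∀ n, f n < 2) (s : ℕ) :
    ∀ a ∈ initSeg f s, a < 2 := by
  intro a ha
  obtain ⟨n, _, rfl⟩ := List.mem_map.1 ha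
  exact hf n

/-- The block of values of `f` on `[a, a + b)`. -/
theorem drop_initSeg (f : ℕ → ℕ) (a b : ℕ) :
    (initSeg f (a + b)).drop a = (List.range b).map fun j => f (a + j) := by
  simp [initSeg, List.range_add, Function.comp_def]

/-! ### Finite approximations of Turing functionals -/

/-- The value at `n` of the `e`-th functional that is found with the part `τ` of the oracle. -/
def approxValue (e : ℕ) (τ : List ℕ) (n : ℕ) : Option ℕ :=
  ((List.range τ.length).filterMap fun k =>
    Nat.Partrec.Code.evaln k.unpair.1 (Denumerable.ofNat Nat.Partrec.Code e)
      (Encodable.encode (τ.take k.unpair.2, n))).head?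

theorem head?_filterMap_range_eq_some {α : Type*} (g : ℕ → Option α) (s : ℕ) (a : α) :
    ((List.range s).filterMap g).head? = some a ↔
      ∃ k < s, g k = some a ∧ ∀ j < k, g j = none := by
  rw [List.head?_filterMap]
  induction s with
  | zero => simp
  | succ s ih =>
    rw [List.range_succ, List.findSome?_append]
    constructor
    · intro h
      rcases ho : List.findSome? g (List.range s) with _ | b
      · rw [ho] at h
        refine ⟨s, Nat.lt_succ_self s, by simpa using h, fun j hj => ?_⟩
        exact List.findSome?_eq_none_iff.1 ho j (List.mem_range.2 hj)
      · rw [ho] at h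
        obtain ⟨k, hk, h'⟩ := ih.1 (by rw [ho]; simpa using h)
        exact ⟨k, hk.trans (Nat.lt_succ_self s), h'⟩
    · rintro ⟨k, hk, hka, hlt⟩
      rcases Nat.lt_succ_iff_lt_or_eq.1 hk with hk | rfl
      · rw [ih.2 ⟨k, hk, hka, hlt⟩]; rfl
      · have : List.findSome? g (List.range k) = none :=
          List.findSome?_eq_none_iff.2 fun j hj => hlt j (List.mem_range.1 hj)
        simp [this, hka]

theorem mem_rfindOpt_iff {α : Type*} (g : ℕ → Option α) (a : α) :
    a ∈ Nat.rfindOpt g ↔ ∃ k, g k = some a ∧ ∀ j < k, g j = none := by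
  unfold Nat.rfindOpt
  simp only [Part.mem_bind_iff, Part.mem_coe, Option.mem_def]
  refine exists_congr fun k => ?_
  rw [and_comm]
  refine and_congr_right fun hk => ?_
  refine Nat.mem_rfind.trans ?_
  simp only [hk, Option.isSome_some, Part.coe_some, Part.mem_some_iff, true_and]
  refine forall₂_congr fun j _ => ?_
  rw [eq_comm, Option.isSome_eq_false_iff, Option.isNone_iff_eq_none]

/-- Stage `k` of the search reads only `k.unpair.2 ≤ k` oracle values, so stages below `s` see
nothing beyond the first `s` values. This makes `approxValue` persistent along an oracle. -/
theorem approxValue_initSeg_eq_some (e : ℕ) (f : ℕ → ℕ) (s n m : ℕ) :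
    approxValue e (initSeg f s) n = some m ↔ ∃ k < s,
      Nat.Partrec.Code.evaln k.unpair.1 (Denumerable.ofNat Nat.Partrec.Code e)
        (Encodable.encode (initSeg f k.unpair.2, n)) = some m ∧ ∀ j < k,
      Nat.Partrec.Code.evaln j.unpair.1 (Denumerable.ofNat Nat.Partrec.Code e)
        (Encodable.encode (initSeg f j.unpair.2, n)) = none := by
  unfold approxValue
  rw [head?_filterMap_range_eq_some, length_initSeg]
  refine exists_congr fun k => and_congr_right fun hk => ?_
  have key : ∀ j ≤ k, (initSeg f s).take j.unpair.2 = initSeg f j.unpair.2 := fun j hj =>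
    take_initSeg f ((Nat.unpair_right_le j).trans (hj.trans hk.le))
  rw [key k le_rfl]
  refine and_congr_right fun _ => forall₂_congr fun j hj => ?_
  rw [key j hj.le]

theorem mem_turingFunctional_iff (e : ℕ) (f : ℕ → ℕ) (n m : ℕ) :
    m ∈ turingFunctional e f n ↔ ∃ s, approxValue e (initSeg f s) n = some m := by
  unfold turingFunctional
  simp only [mem_rfindOpt_iff, approxValue_initSeg_eq_some]
  exact ⟨fun ⟨k, h⟩ => ⟨k + 1, k, Nat.lt_succ_self k, h⟩, fun ⟨_, k, _, h⟩ => ⟨k, h⟩⟩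

theorem approxValue_initSeg_mono {e : ℕ} {f : ℕ → ℕ} {s t n m : ℕ} (hst : s ≤ t)
    (h : approxValue e (initSeg f s) n = some m) : approxValue e (initSeg f t) n = some m := by
  rw [approxValue_initSeg_eq_some] at h ⊢
  obtain ⟨k, hk, h⟩ := h
  exact ⟨k, hk.trans_le hst, h⟩

theorem primrec_approxValue :
    Primrec fun p : ℕ × List ℕ × ℕ => approxValue p.1 p.2.1 p.2.2 := by
  unfold approxValue
  refine Primrec.list_head?.comp (Primrec.listFilterMap
    (Primrec.list_range.comp (Primrec.list_length.comp (Primrec.fst.comp Primrec.snd))) ?_)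
  have hk : Primrec fun q : (ℕ × List ℕ × ℕ) × ℕ => q.2.unpair :=
    Primrec.unpair.comp Primrec.snd
  refine Nat.Partrec.Code.primrec_evaln.comp (((Primrec.fst.comp hk).pair
    ((Primrec.ofNat _).comp (Primrec.fst.comp Primrec.fst))).pair (Primrec.encode.comp
      ((Primrec.list_take.comp (Primrec.snd.comp hk) ?_).pair ?_)))
  · exact Primrec.fst.comp (Primrec.snd.comp Primrec.fst)
  · exact Primrec.snd.comp (Primrec.snd.comp Primrec.fst)

/-- A computable assignment of values to finite parts of oracles whose values persist along
`f` is given along `f` by a Turing functional. -/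
theorem exists_computes (F : List ℕ → ℕ → Option ℕ) (hF : Computable₂ F) :
    ∃ e : ℕ, ∀ f h : ℕ → ℕ,
      (∀ n s t a, s ≤ t → F (initSeg f s) n = some a → F (initSeg f t) n = some a) →
      (∀ n, ∃ s, F (initSeg f s) n = some (h n)) → Computes e f h := by
  obtain ⟨e, he⟩ := exists_turingFunctional (fun τ n => (F τ n : Part ℕ)) hF.ofOption
  refine ⟨e, fun f h hmono htot n => ?_⟩
  have hcons : ∀ s t a b : ℕ, a ∈ (F (initSeg f s) n : Part ℕ) →
      b ∈ (F (initSeg f t) n : Part ℕ) → a = b := by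
    intro s t a b ha hb
    have ha' := hmono n s (max s t) a (le_max_left s t) (by simpa using ha)
    have hb' := hmono n t (max s t) b (le_max_right s t) (by simpa using hb)
    exact Option.some_injective _ (ha'.symm.trans hb')
  rw [he f n hcons]
  obtain ⟨s, hs⟩ := htot n
  exact ⟨s, by simpa using hs⟩

/-- A functional searches for a witness `w` against some initial segment. Its only possible output
is `0`, so searches along different initial segments never conflict. -/
theorem isPi01Cantor_of_primrecPred (B : List ℕ × ℕ → Prop) (hB : PrimrecPred B) :
    IsPi01Cantor {f | (∀ n, f n < 2) ∧ ∀ s w, ¬ B (initSeg f s, w)} := by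
  obtain ⟨_, hB⟩ := hB
  have hF : Partrec₂ fun (τ : List ℕ) (_ : ℕ) =>
      (Nat.rfind fun w => (decide (B (τ, w)) : Part Bool)).map fun _ => 0 := by
    refine Partrec.map (Partrec.rfind ?_) (Computable.const 0).to₂
    exact (hB.comp ((Primrec.fst.comp Primrec.fst).pair Primrec.snd)).to_comp.partrec
  obtain ⟨e, he⟩ := exists_turingFunctional _ hF
  refine ⟨e, Set.ext fun f => and_congr_right fun _ => ?_⟩
  have key : (turingFunctional e f 0).Dom ↔ ∃ s w, B (initSeg f s, w) := by
    have hcons : ∀ s t a b : ℕ,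
        a ∈ (Nat.rfind fun w => (decide (B (initSeg f s, w)) : Part Bool)).map (fun _ => 0) →
        b ∈ (Nat.rfind fun w => (decide (B (initSeg f t, w)) : Part Bool)).map (fun _ => 0) →
        a = b := by
      intro s t a b ha hb
      rw [Part.mem_map_iff] at ha hb
      obtain ⟨_, _, rfl⟩ := ha
      obtain ⟨_, _, rfl⟩ := hb
      rfl
    rw [Part.dom_iff_mem]
    constructor
    · rintro ⟨m, hm⟩
      obtain ⟨s, hs⟩ := (he f 0 hcons m).1 hm
      obtain ⟨w, hw, _⟩ := (Part.mem_map_iff _).1 hs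
      exact ⟨s, w, by simpa using Nat.rfind_spec hw⟩
    · rintro ⟨s, w, hw⟩
      refine ⟨0, (he f 0 hcons 0).2 ⟨s, (Part.mem_map_iff _).2 ?_⟩⟩
      have hd : (Nat.rfind fun w => (decide (B (initSeg f s, w)) : Part Bool)).Dom :=
        Nat.rfind_dom.2 ⟨w, by simpa using hw, fun _ => trivial⟩
      exact ⟨_, Part.get_mem hd, rfl⟩
  rw [key]
  push Not
  rfl

/-! ### Binary strings -/

/-- The list of all binary strings of length `n`. -/
def binStrings : ℕ → List (List ℕ) :=
  Nat.rec [[]] fun _ l => l.flatMap fun τ => [0 :: τ, 1 :: τ]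

theorem primrec_binStrings : Primrec binStrings := by
  refine Primrec.nat_rec₁ _ (Primrec.list_flatMap Primrec.snd ?_)
  refine Primrec.list_cons.comp (Primrec.list_cons.comp (Primrec.const 0) Primrec.snd) ?_
  exact Primrec.list_cons.comp (Primrec.list_cons.comp (Primrec.const 1) Primrec.snd)
    (Primrec.const [])

theorem mem_binStrings {n : ℕ} {τ : List ℕ} :
    τ ∈ binStrings n ↔ τ.length = n ∧ ∀ a ∈ τ, a < 2 := by
  induction n generalizing τ with
  | zero =>
    change τ ∈ [[]] ↔ _
    rw [List.mem_singleton, List.length_eq_zero_iff]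
    exact ⟨fun h => ⟨h, by simp [h]⟩, fun h => h.1⟩
  | succ n ih =>
    change τ ∈ (binStrings n).flatMap _ ↔ _
    simp only [List.mem_flatMap, List.mem_cons, List.not_mem_nil, or_false, ih]
    constructor
    · rintro ⟨ρ, ⟨hl, hb⟩, rfl | rfl⟩ <;> simpa [hl] using hb
    · rintro ⟨hl, hb⟩
      obtain ⟨a, ρ, rfl⟩ := List.exists_cons_of_length_eq_add_one hl
      refine ⟨ρ, ⟨by simpa using hl, fun b hb' => hb b (List.mem_cons_of_mem a hb')⟩, ?_⟩
      have := hb a List.mem_cons_self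
      interval_cases a <;> simp

theorem nodup_binStrings (n : ℕ) : (binStrings n).Nodup := by
  induction n with
  | zero => simp [binStrings]
  | succ n ih =>
    change ((binStrings n).flatMap _).Nodup
    rw [List.nodup_flatMap]
    refine ⟨by simp, ih.imp fun {σ τ} h => ?_⟩
    simp [Function.onFun, h.symm]

theorem length_binStrings (n : ℕ) : (binStrings n).length = 2 ^ n := by
  induction n with
  | zero => simp [binStrings]
  | succ n ih =>
    change ((binStrings n).flatMap _).length = _
    simp [List.length_flatMap, ih, pow_succ]

/-- The finite set of all binary strings of length `n`. -/
def binFinset (n : ℕ) : Finset (List ℕ) := ⟨binStrings n, nodup_binStrings n⟩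

theorem mem_binFinset {n : ℕ} {τ : List ℕ} :
    τ ∈ binFinset n ↔ τ.length = n ∧ ∀ a ∈ τ, a < 2 := mem_binStrings

theorem card_binFinset (n : ℕ) : (binFinset n).card = 2 ^ n := length_binStrings n

/-- König's lemma for binary strings. -/
theorem exists_forall_initSeg (p : List ℕ → Prop) (hpre : ∀ τ s, p τ → p (τ.take s))
    (hex : ∀ s, ∃ τ, τ.length = s ∧ (∀ a ∈ τ, a < 2) ∧ p τ) :
    ∃ f : ℕ → ℕ, (∀ n, f n < 2) ∧ ∀ s, p (initSeg f s) := by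
  let α : ℕ → Type := fun s => {τ : List ℕ // τ.length = s ∧ (∀ a ∈ τ, a < 2) ∧ p τ}
  have hfin : ∀ s, Finite (α s) := fun s =>
    Set.Finite.subset (binFinset s).finite_toSet fun τ h => mem_binFinset.2 ⟨h.1, h.2.1⟩
  have : ∀ s, Nonempty (α s) := fun s => let ⟨τ, h⟩ := hex s; ⟨τ, h⟩
  obtain ⟨F, hF⟩ := exists_seq_forall_proj_of_forall_finite (α := α)
    (fun {i j} hij τ => ⟨τ.1.take i, by simp [τ.2.1, hij],
      fun a ha => τ.2.2.1 a (List.mem_of_mem_take ha), hpre _ _ τ.2.2.2⟩)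
    (fun i a => Subtype.ext (List.take_of_length_le a.2.1.le))
    (fun i j k hij hjk a => Subtype.ext (by simp [List.take_take, hij]))
    (fun i a => Set.toFinite _)
  have hget : ∀ s, initSeg (fun n => (F (n + 1)).1.getD n 0) s = (F s).1 := by
    intro s
    refine Eq.trans ?_ (initSeg_getD (F s).1)
    rw [(F s).2.1]
    refine initSeg_congr fun n hn => ?_
    have := congrArg Subtype.val (hF (Nat.succ_le_of_lt hn))
    simp only at this
    rw [← this]
    simp
  refine ⟨fun n => (F (n + 1)).1.getD n 0, fun n => ?_, fun s => hget s ▸ (F s).2.2.2⟩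
  have hlen : n < (F (n + 1)).1.length := by rw [(F (n + 1)).2.1]; exact Nat.lt_succ_self n
  simp only [List.getD_eq_getElem?_getD, List.getElem?_eq_getElem hlen, Option.getD_some]
  exact (F (n + 1)).2.2.1 _ (List.getElem_mem hlen)

theorem exists_extension (σ : List ℕ) (p : List ℕ → Prop) (hpre : ∀ τ s, p τ → p (τ.take s))
    (hex : ∀ t : ℕ, ∃ ρ : List ℕ, t ≤ ρ.length ∧ (∀ a ∈ σ ++ ρ, a < 2) ∧ p (σ ++ ρ)) :
    ∃ f : ℕ → ℕ, (∀ n, f n < 2) ∧ initSeg f σ.length = σ ∧ ∀ s, p (initSeg f s) := by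
  -- König's lemma is applied to the tree of strings comparable with `σ`.
  obtain ⟨f, hf, h⟩ := exists_forall_initSeg
    (fun τ => p τ ∧ τ.take σ.length = σ.take τ.length)
    (fun τ s hτ => ⟨hpre τ s hτ.1, by
      rw [List.take_take, List.length_take, min_comm, ← List.take_take, hτ.2, List.take_take,
        min_comm]⟩)
    (fun s => by
      obtain ⟨ρ, hρ, hb, hp⟩ := hex s
      have hl : ((σ ++ ρ).take s).length = s := by simp; omega
      refine ⟨(σ ++ ρ).take s, hl, fun a ha => hb a (List.mem_of_mem_take ha), hpre _ _ hp, ?_⟩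
      rw [hl, List.take_take, min_comm, ← List.take_take, List.take_left])
  refine ⟨f, hf, ?_, fun s => (h s).1⟩
  have := (h σ.length).2
  rw [length_initSeg, List.take_length] at this
  rw [← this]
  simp

/-! ### A pair of classes defined by blocks -/

/-- The values on the block `[4 ^ k, 4 ^ (k + 1))` that the functional with the index coded by `k`
finds with the part `τ` of the oracle. -/
def blockOutput (k : ℕ) (τ : List ℕ) : List (Option ℕ) :=
  (List.range (3 * 4 ^ k)).map fun j => approxValue (k / 2).unpair.1 τ (4 ^ k + j)

/-- The number of binary extensions of `σ` by `l` bits from which the `k`-th block is found to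
be `v`. -/
def outputCount (k : ℕ) (σ v : List ℕ) (l : ℕ) : ℕ :=
  ((binStrings l).filter fun τ => blockOutput k (σ ++ τ) = v.map some).length

/-- The list with the code `n`. -/
def listOfCode (n : ℕ) : List ℕ := (Encodable.decode n).getD []

theorem listOfCode_encode (v : List ℕ) : listOfCode (Encodable.encode v) = v := by
  simp [listOfCode]

theorem primrec_listOfCode : Primrec listOfCode :=
  Primrec.option_getD.comp Primrec.decode (Primrec.const [])

/-- The number `n` codes a length and a value of the `k`-th block that is computed from a
substantial fraction of the extensions of `σ` of that length. -/
def IsFrequent (k : ℕ) (σ : List ℕ) (n : ℕ) : Prop :=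
  2 ^ (4 ^ (k + 1 + n.unpair.1) - 4 ^ k) ≤ 2 ^ (3 * 4 ^ k + 1) *
    outputCount k σ (listOfCode n.unpair.2) (4 ^ (k + 1 + n.unpair.1) - 4 ^ k)

/-- The value `v` of the `k`-th block is the first frequent one above `σ`. -/
def IsSelectedBy (k : ℕ) (σ v : List ℕ) (n : ℕ) : Prop :=
  IsFrequent k σ n ∧ (∀ m < n, ¬ IsFrequent k σ m) ∧
    listOfCode n.unpair.2 = v

/-- The values of the `k`-th block that are forbidden. -/
def IsForbidden (k : ℕ) (v : List ℕ) : Prop :=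
  ∃ σ ∈ binFinset (4 ^ k), ∃ n, IsSelectedBy k σ v n

/-- No complete block of `τ` whose number has the parity `i` has a forbidden value. -/
def Allowed (i : ℕ) (τ : List ℕ) : Prop :=
  ∀ k, k % 2 = i → 4 ^ (k + 1) ≤ τ.length →
    ¬ IsForbidden k ((τ.take (4 ^ (k + 1))).drop (4 ^ k))

/-- The class of binary sequences with no forbidden block of parity `i`. -/
def blockClass (i : ℕ) : Set (ℕ → ℕ) :=
  {f | (∀ n, f n < 2) ∧ ∀ s, Allowed i (initSeg f s)}

theorem four_pow_succ' (k : ℕ) : 4 ^ (k + 1) = 4 ^ k + 3 * 4 ^ k := by ring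

/-! ### Effectivity of the forbidding procedure -/

theorem primrec_pow {α : Type*} [Primcodable α] {f g : α → ℕ} (hf : Primrec f)
    (hg : Primrec g) : Primrec fun a => f a ^ g a :=
  (Primrec₂.unpaired'.1 Nat.Primrec.pow).comp hf hg

theorem primrec_blockOutput : Primrec₂ blockOutput := by
  refine Primrec.list_map (Primrec.list_range.comp (Primrec.nat_mul.comp (Primrec.const 3)
    (primrec_pow (Primrec.const 4) Primrec.fst))) ?_
  refine primrec_approxValue.comp (Primrec.pair ?_ (Primrec.pair ?_ ?_))
  · exact Primrec.fst.comp (Primrec.unpair.comp (Primrec.nat_div.comp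
      (Primrec.fst.comp Primrec.fst) (Primrec.const 2)))
  · exact Primrec.snd.comp Primrec.fst
  · exact Primrec.nat_add.comp (primrec_pow (Primrec.const 4) (Primrec.fst.comp Primrec.fst))
      Primrec.snd

theorem primrec_outputCount :
    Primrec fun q : (ℕ × List ℕ × List ℕ) × ℕ => outputCount q.1.1 q.1.2.1 q.1.2.2 q.2 := by
  have hR : PrimrecRel fun (τ : List ℕ) (q : ℕ × List ℕ × List ℕ) =>
      blockOutput q.1 (q.2.1 ++ τ) = q.2.2.map some := by
    refine Primrec.eq.comp (primrec_blockOutput.comp (Primrec.fst.comp Primrec.snd)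
      (Primrec.list_append.comp (Primrec.fst.comp (Primrec.snd.comp Primrec.snd))
        Primrec.fst)) ?_
    exact Primrec.list_map (Primrec.snd.comp (Primrec.snd.comp Primrec.snd))
      (Primrec.option_some.comp Primrec.snd).to₂
  exact Primrec.list_length.comp (hR.listFilter.comp
    (primrec_binStrings.comp Primrec.snd) Primrec.fst)

theorem primrecPred_isFrequent :
    PrimrecPred fun p : (ℕ × List ℕ) × ℕ => IsFrequent p.1.1 p.1.2 p.2 := by
  have hk : Primrec fun p : (ℕ × List ℕ) × ℕ => p.1.1 := Primrec.fst.comp Primrec.fst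
  have hσ : Primrec fun p : (ℕ × List ℕ) × ℕ => p.1.2 := Primrec.snd.comp Primrec.fst
  have hn : Primrec fun p : (ℕ × List ℕ) × ℕ => p.2.unpair := Primrec.unpair.comp Primrec.snd
  have hlen : Primrec fun p : (ℕ × List ℕ) × ℕ => 4 ^ (p.1.1 + 1 + p.2.unpair.1) - 4 ^ p.1.1 :=
    Primrec.nat_sub.comp (primrec_pow (Primrec.const 4) (Primrec.nat_add.comp
      (Primrec.succ.comp hk) (Primrec.fst.comp hn))) (primrec_pow (Primrec.const 4) hk)
  have hv : Primrec fun p : (ℕ × List ℕ) × ℕ => listOfCode p.2.unpair.2 :=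
    primrec_listOfCode.comp (Primrec.snd.comp hn)
  have hbound : Primrec fun p : (ℕ × List ℕ) × ℕ => 2 ^ (3 * 4 ^ p.1.1 + 1) :=
    primrec_pow (Primrec.const 2) (Primrec.succ.comp (Primrec.nat_mul.comp (Primrec.const 3)
      (primrec_pow (Primrec.const 4) hk)))
  have hcount := primrec_outputCount.comp ((hk.pair (hσ.pair hv)).pair hlen)
  exact Primrec.nat_le.comp (primrec_pow (Primrec.const 2) hlen)
    (Primrec.nat_mul.comp hbound hcount)

theorem primrecPred_isSelectedBy :
    PrimrecPred fun p : (ℕ × List ℕ) × List ℕ × ℕ => IsSelectedBy p.1.1 p.1.2 p.2.1 p.2.2 := by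
  have hn : Primrec fun p : (ℕ × List ℕ) × List ℕ × ℕ => p.2.2 := Primrec.snd.comp Primrec.snd
  refine (primrecPred_isFrequent.comp (Primrec.fst.pair hn)).and (PrimrecPred.and ?_ ?_)
  · have h : PrimrecRel fun (m : ℕ) (q : ℕ × List ℕ) => ¬ IsFrequent q.1 q.2 m :=
      (primrecPred_isFrequent.comp (Primrec.snd.pair Primrec.fst)).not
    exact (h.forall_mem_list.comp (Primrec.list_range.comp hn) Primrec.fst).of_eq fun p => by
      simp only [List.mem_range]
  · exact Primrec.eq.comp (primrec_listOfCode.comp (Primrec.snd.comp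
      (Primrec.unpair.comp hn))) (Primrec.fst.comp Primrec.snd)

/-! ### Counting forbidden values and allowed strings -/

theorem IsSelectedBy.unique {k : ℕ} {σ v w : List ℕ} {m n : ℕ} (hv : IsSelectedBy k σ v m)
    (hw : IsSelectedBy k σ w n) : v = w := by
  have : m = n := le_antisymm (not_lt.1 fun h => hv.2.1 n h hw.1)
    (not_lt.1 fun h => hw.2.1 m h hv.1)
  subst this
  exact hv.2.2.symm.trans hw.2.2

-- Each string of length `4 ^ k` selects at most one value, so mapping a forbidden value to a string
-- selecting it is injective.
open Classical in
theorem card_filter_isForbidden_le (k : ℕ) (A : Finset (List ℕ)) :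
    (A.filter (IsForbidden k)).card ≤ 2 ^ 4 ^ k := by
  rw [← card_binFinset]
  have hsel : ∀ v ∈ A.filter (IsForbidden k), ∃ σ ∈ binFinset (4 ^ k),
      ∃ n, IsSelectedBy k σ v n := fun v hv => (Finset.mem_filter.1 hv).2
  choose! F hF using hsel
  refine Finset.card_le_card_of_injOn F (fun v hv => (hF v hv).1) fun v hv w hw h => ?_
  obtain ⟨m, hm⟩ := (hF v hv).2
  obtain ⟨n, hn⟩ := (hF w hw).2
  rw [h] at hm
  exact hm.unique hn

theorem Allowed.take {i : ℕ} {τ : List ℕ} (h : Allowed i τ) (s : ℕ) : Allowed i (τ.take s) := by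
  intro k hk hl
  rw [List.length_take, le_min_iff] at hl
  rw [List.take_take, min_eq_left hl.1]
  exact h k hk hl.2

theorem Allowed.append {i L : ℕ} {τ ρ : List ℕ} (h : Allowed i τ) (hτ : τ.length = 4 ^ L)
    (hρ : ρ.length = 3 * 4 ^ L) (hL : L % 2 = i → ¬ IsForbidden L ρ) : Allowed i (τ ++ ρ) := by
  intro k hk hl
  have hlen : (τ ++ ρ).length = 4 ^ (L + 1) := by
    rw [List.length_append, hτ, hρ, four_pow_succ']
  rw [hlen, Nat.pow_le_pow_iff_right (by norm_num)] at hl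
  rcases (Nat.le_of_succ_le_succ hl).lt_or_eq with hlt | rfl
  · have : 4 ^ (k + 1) ≤ τ.length := hτ ▸ Nat.pow_le_pow_right (by norm_num) hlt
    rw [List.take_append_of_le_length this]
    exact h k hk this
  · rw [← hlen, List.take_length, ← hτ, List.drop_left]
    exact hL hk

open Classical in
/-- The allowed strings of length `4 ^ L` above the string `σ` of length `4 ^ k`, without
their initial segment `σ`. -/
noncomputable def allowedAbove (i k : ℕ) (σ : List ℕ) (L : ℕ) : Finset (List ℕ) :=
  (binFinset (4 ^ L - 4 ^ k)).filter fun τ => Allowed i (σ ++ τ)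

theorem mem_allowedAbove {i k : ℕ} {σ : List ℕ} {L : ℕ} {τ : List ℕ} :
    τ ∈ allowedAbove i k σ L ↔
      (τ.length = 4 ^ L - 4 ^ k ∧ ∀ a ∈ τ, a < 2) ∧ Allowed i (σ ++ τ) := by
  classical
  rw [allowedAbove, Finset.mem_filter, mem_binFinset]

/-- At most `2 ^ 4 ^ L` of the values of the next block are forbidden; appending any other keeps a
string allowed. -/
theorem card_allowedAbove_succ {i k L : ℕ} {σ : List ℕ} (hσ : σ.length = 4 ^ k) (hkL : k ≤ L) :
    (allowedAbove i k σ L).card * (2 ^ (3 * 4 ^ L) - 2 ^ 4 ^ L) ≤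
      (allowedAbove i k σ (L + 1)).card := by
  classical
  have hpow : 4 ^ k ≤ 4 ^ L := Nat.pow_le_pow_right (by norm_num) hkL
  have hB : 2 ^ (3 * 4 ^ L) - 2 ^ 4 ^ L ≤
      ((binFinset (3 * 4 ^ L)).filter fun ρ => ¬ IsForbidden L ρ).card := by
    have h := Finset.card_filter_add_card_filter_not (s := binFinset (3 * 4 ^ L))
      (IsForbidden L)
    rw [card_binFinset] at h
    have := card_filter_isForbidden_le L (binFinset (3 * 4 ^ L))
    omega
  refine (Nat.mul_le_mul_left _ hB).trans ?_
  rw [← Finset.card_product]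
  refine Finset.card_le_card_of_injOn (fun q => q.1 ++ q.2) ?_ ?_
  · rintro ⟨τ, ρ⟩ h
    simp only [Finset.coe_product, Set.mem_prod, Finset.mem_coe, mem_allowedAbove,
      Finset.mem_filter, mem_binFinset] at h ⊢
    obtain ⟨⟨⟨hτ, hτb⟩, hτa⟩, ⟨hρ, hρb⟩, hρf⟩ := h
    refine ⟨⟨?_, ?_⟩, ?_⟩
    · rw [List.length_append, hτ, hρ, four_pow_succ']
      omega
    · intro a ha
      exact (List.mem_append.1 ha).elim (hτb a) (hρb a)
    · rw [← List.append_assoc]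
      refine hτa.append ?_ hρ fun _ => hρf
      rw [List.length_append, hσ, hτ]
      omega
  · rintro ⟨τ, ρ⟩ h ⟨τ', ρ'⟩ h' heq
    simp only [Finset.coe_product, Set.mem_prod, Finset.mem_coe, mem_allowedAbove] at h h'
    obtain ⟨h₁, h₂⟩ := List.append_inj heq (h.1.1.1.trans h'.1.1.1.symm)
    exact Prod.ext h₁ h₂

/-- Block `k` has the wrong parity to be restricted, and each later block `L` costs at most a factor
`1 - x ^ 2` with `x = (1 / 2) ^ 4 ^ L`. The extra summand carries the induction and later gives a
strict inequality. -/
theorem le_card_allowedAbove_div {i k : ℕ} {σ : List ℕ} (hσ : σ.length = 4 ^ k)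
    (ha : Allowed i σ) (hk : k % 2 ≠ i) (t : ℕ) :
    1 - (1 / 2 : ℝ) ^ (3 * 4 ^ k + 1) + (1 / 2) ^ 4 ^ (k + 1 + t) ≤
      (allowedAbove i k σ (k + 1 + t)).card / 2 ^ (4 ^ (k + 1 + t) - 4 ^ k) := by
  induction t with
  | zero =>
    have hfull : allowedAbove i k σ (k + 1) = binFinset (3 * 4 ^ k) := by
      ext τ
      have : 4 ^ (k + 1) - 4 ^ k = 3 * 4 ^ k := by rw [four_pow_succ']; omega
      rw [mem_allowedAbove, mem_binFinset, this, and_iff_left_iff_imp]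
      exact fun h => ha.append hσ h.1 fun h' => absurd h' hk
    have hd : 4 ^ (k + 1) - 4 ^ k = 3 * 4 ^ k := by rw [four_pow_succ']; omega
    rw [add_zero, hfull, card_binFinset, hd]
    push_cast
    rw [div_self (by positivity)]
    have : (1 / 2 : ℝ) ^ 4 ^ (k + 1) ≤ (1 / 2) ^ (3 * 4 ^ k + 1) := by
      apply pow_le_pow_of_le_one (by norm_num) (by norm_num)
      rw [four_pow_succ']
      have := Nat.one_le_pow k 4 (by norm_num)
      omega
    linarith
  | succ t ih =>
    set L := k + 1 + t with hL
    have hkL : 4 ^ k ≤ 4 ^ L := Nat.pow_le_pow_right (by norm_num) (by omega)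
    have hstep := card_allowedAbove_succ (i := i) hσ (L := L) (by omega)
    have hle : 2 ^ 4 ^ L ≤ 2 ^ (3 * 4 ^ L) := Nat.pow_le_pow_right (by norm_num) (by omega)
    have hstep' : ((allowedAbove i k σ L).card : ℝ) * (2 ^ (3 * 4 ^ L) - 2 ^ 4 ^ L) ≤
        (allowedAbove i k σ (L + 1)).card := by
      rw [← Nat.cast_ofNat, ← Nat.cast_pow, ← Nat.cast_pow, ← Nat.cast_sub hle]
      exact_mod_cast hstep
    have hexp : 4 ^ (L + 1) - 4 ^ k = (4 ^ L - 4 ^ k) + 3 * 4 ^ L := by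
      rw [four_pow_succ']; omega
    rw [show k + 1 + (t + 1) = L + 1 by omega, hexp, pow_add (2 : ℝ)]
    set c : ℝ := ((allowedAbove i k σ L).card : ℝ)
    set D : ℝ := 2 ^ (4 ^ L - 4 ^ k) with hD
    have hDpos : 0 < D := by positivity
    set x : ℝ := (1 / 2) ^ 4 ^ L with hx
    have hx0 : 0 < x := by positivity
    have hx2 : x ≤ 1 / 2 := by
      have := pow_le_pow_of_le_one (a := (1 / 2 : ℝ)) (by norm_num) (by norm_num)
        (Nat.one_le_pow L 4 (by norm_num))
      simpa [hx] using this
    have hx4 : (1 / 2 : ℝ) ^ 4 ^ (L + 1) = x ^ 4 := by rw [hx, ← pow_mul, pow_succ]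
    have hy : (2 : ℝ) ^ 4 ^ L = x⁻¹ := by rw [hx, one_div, inv_pow, inv_inv]
    have hz : (2 : ℝ) ^ (3 * 4 ^ L) = (x⁻¹) ^ 3 := by rw [← hy, ← pow_mul, mul_comm]
    rw [hx4]
    have hc1 : c / D ≤ 1 := by
      rw [div_le_one hDpos, hD]
      have : (allowedAbove i k σ L).card ≤ 2 ^ (4 ^ L - 4 ^ k) := by
        classical
        exact (Finset.card_filter_le _ _).trans_eq (card_binFinset _)
      have h : ((allowedAbove i k σ L).card : ℝ) ≤ 2 ^ (4 ^ L - 4 ^ k) := by exact_mod_cast this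
      exact h
    -- The summand drops from `x` to `x ^ 4`; this slack pays for the loss `x ^ 2`.
    have hx3 : x ^ 2 + x ^ 4 ≤ x := by
      have h1 : x ^ 2 ≤ 1 / 2 * x := by nlinarith
      have h2 : x ^ 4 = x ^ 2 * x ^ 2 := by ring
      nlinarith [sq_nonneg x]
    calc 1 - (1 / 2 : ℝ) ^ (3 * 4 ^ k + 1) + x ^ 4
        ≤ c / D - x ^ 2 := by linarith
      _ ≤ c / D * (1 - x ^ 2) := by nlinarith [sq_nonneg x]
      _ = c * (2 ^ (3 * 4 ^ L) - 2 ^ 4 ^ L) / (D * 2 ^ (3 * 4 ^ L)) := by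
          rw [hy, hz]; field_simp
      _ ≤ _ := by gcongr

/-- Since `2 ^ 4 ^ L < 2 ^ (3 * 4 ^ L)`, a permitted next block always exists. Ending at a block
boundary matters: a partial block might have only forbidden completions. -/
theorem exists_mem_blockClass {i k : ℕ} {σ : List ℕ} (hσ : σ.length = 4 ^ k)
    (hb : ∀ a ∈ σ, a < 2) (ha : Allowed i σ) : ∃ g ∈ blockClass i, initSeg g (4 ^ k) = σ := by
  have hne : ∀ t, (allowedAbove i k σ (k + t)).Nonempty := by
    intro t
    induction t with
    | zero => exact ⟨[], mem_allowedAbove.2 ⟨by simp, by simpa using ha⟩⟩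
    | succ t ih =>
      rw [← Finset.card_pos] at ih ⊢
      refine lt_of_lt_of_le (Nat.mul_pos ih ?_) (card_allowedAbove_succ hσ (Nat.le_add_right k t))
      have := Nat.one_le_pow (k + t) 4 (by norm_num)
      exact Nat.sub_pos_of_lt (Nat.pow_lt_pow_right (by norm_num) (by omega))
  obtain ⟨f, hf, hfσ, hfa⟩ := exists_extension σ (Allowed i) (fun τ s h => h.take s) fun t => by
    obtain ⟨ρ, hρ⟩ := hne t
    obtain ⟨⟨hl, hρb⟩, hρa⟩ := mem_allowedAbove.1 hρ
    refine ⟨ρ, ?_, fun a ha => (List.mem_append.1 ha).elim (hb a) (hρb a), hρa⟩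
    rw [hl, pow_add, Nat.le_sub_iff_add_le (Nat.le_mul_of_pos_right _ (by positivity))]
    have h1 := Nat.one_le_pow k 4 (by norm_num)
    have h2 : t + 1 ≤ 4 ^ t := Nat.lt_pow_self (by norm_num)
    nlinarith
  exact ⟨f, ⟨hf, hfa⟩, hσ ▸ hfσ⟩

/-! ### Blocks of outputs and the incomparability of the two classes -/

theorem blockOutput_eq_map_some_iff {k : ℕ} {τ v : List ℕ} :
    blockOutput k τ = v.map some ↔ v.length = 3 * 4 ^ k ∧
      ∀ j < 3 * 4 ^ k, approxValue (k / 2).unpair.1 τ (4 ^ k + j) = some (v.getD j 0) := by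
  constructor
  · intro h
    have hl : v.length = 3 * 4 ^ k := by
      simpa [blockOutput] using (congrArg List.length h).symm
    refine ⟨hl, fun j hj => ?_⟩
    have := congrArg (fun l : List (Option ℕ) => l[j]?) h
    simpa [blockOutput, hj, hl] using this
  · rintro ⟨hl, h⟩
    apply List.ext_getElem
    · simp [blockOutput, hl]
    · intro j h₁ h₂
      have hj : j < 3 * 4 ^ k := by simpa [blockOutput] using h₁
      simp [blockOutput, h j hj, hl, hj]

theorem blockOutput_initSeg_mono {k s t : ℕ} {g : ℕ → ℕ} {v : List ℕ} (hst : s ≤ t)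
    (h : blockOutput k (initSeg g s) = v.map some) :
    blockOutput k (initSeg g t) = v.map some := by
  rw [blockOutput_eq_map_some_iff] at h ⊢
  exact ⟨h.1, fun j hj => approxValue_initSeg_mono hst (h.2 j hj)⟩

theorem blockOutput_of_take {k s : ℕ} {τ v : List ℕ}
    (h : blockOutput k (τ.take s) = v.map some) : blockOutput k τ = v.map some := by
  rcases le_total τ.length s with hs | hs
  · rwa [List.take_of_length_le hs] at h
  · rw [← initSeg_getD τ, take_initSeg _ hs] at h
    rw [← initSeg_getD τ]
    exact blockOutput_initSeg_mono hs h

/-- The `k`-th block of `h`. -/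
theorem drop_initSeg_block (h : ℕ → ℕ) (k : ℕ) :
    (initSeg h (4 ^ (k + 1))).drop (4 ^ k) =
      (List.range (3 * 4 ^ k)).map fun j => h (4 ^ k + j) := by
  rw [four_pow_succ', drop_initSeg]

theorem Computes.exists_blockOutput {k : ℕ} {g h : ℕ → ℕ}
    (hgh : Computes (k / 2).unpair.1 g h) : ∃ s, blockOutput k (initSeg g s) =
      ((initSeg h (4 ^ (k + 1))).drop (4 ^ k)).map some := by
  have hex : ∀ n, ∃ s, approxValue (k / 2).unpair.1 (initSeg g s) n = some (h n) := fun n =>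
    (mem_turingFunctional_iff _ _ _ _).1 (hgh n)
  choose s hs using hex
  refine ⟨(Finset.range (4 ^ (k + 1))).sup s, blockOutput_eq_map_some_iff.2 ⟨?_, ?_⟩⟩
  · simp [drop_initSeg_block]
  · intro j hj
    have hmem : 4 ^ k + j ∈ Finset.range (4 ^ (k + 1)) := by
      rw [Finset.mem_range, four_pow_succ']; omega
    rw [approxValue_initSeg_mono (Finset.le_sup hmem) (hs _)]
    simp [drop_initSeg_block, hj]

theorem Computes.eq_of_blockOutput {k s : ℕ} {g h : ℕ → ℕ} {v : List ℕ}
    (hgh : Computes (k / 2).unpair.1 g h) (hv : blockOutput k (initSeg g s) = v.map some) :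
    v = (initSeg h (4 ^ (k + 1))).drop (4 ^ k) := by
  obtain ⟨t, ht⟩ := hgh.exists_blockOutput
  have := (blockOutput_initSeg_mono (le_max_left s t) hv).symm.trans
    (blockOutput_initSeg_mono (le_max_right s t) ht)
  exact (Option.some_injective ℕ).list_map this

theorem outputCount_eq_card (k : ℕ) (σ v : List ℕ) (l : ℕ) :
    outputCount k σ v l =
      ((binFinset l).filter fun τ => blockOutput k (σ ++ τ) = v.map some).card := rfl

theorem exists_blockClass_extension {i k L : ℕ} {σ τ : List ℕ} (hkL : k ≤ L)
    (hσ : σ.length = 4 ^ k) (hb : ∀ a ∈ σ, a < 2) (hτ : τ ∈ allowedAbove i k σ L) :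
    ∃ g ∈ blockClass i, initSeg g (4 ^ k) = σ ∧ initSeg g (4 ^ L) = σ ++ τ := by
  obtain ⟨⟨hl, hτb⟩, hτa⟩ := mem_allowedAbove.1 hτ
  have hpow : 4 ^ k ≤ 4 ^ L := Nat.pow_le_pow_right (by norm_num) hkL
  have hlen : (σ ++ τ).length = 4 ^ L := by rw [List.length_append, hσ, hl]; omega
  obtain ⟨g, hg, hgτ⟩ := exists_mem_blockClass hlen
    (fun a ha => (List.mem_append.1 ha).elim (hb a) (hτb a)) hτa
  refine ⟨g, hg, ?_, hgτ⟩
  rw [← take_initSeg g hpow, hgτ, ← hσ, List.take_left]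

/-- If a functional maps all members of a class above `σ` to sequences, then some length suffices
to find the `k`-th block of the output. -/
theorem exists_length_blockOutput {i k : ℕ} {σ : List ℕ} (hσ : σ.length = 4 ^ k)
    (hb : ∀ a ∈ σ, a < 2) (hcomp : ∀ g ∈ blockClass i, initSeg g (4 ^ k) = σ →
      ∃ h, Computes (k / 2).unpair.1 g h) :
    ∃ t, ∀ τ ∈ allowedAbove i k σ (k + 1 + t), ∃ v : List ℕ, blockOutput k (σ ++ τ) = v.map some := by
  by_contra! hno
  obtain ⟨f, hf, hfσ, hfp⟩ := exists_extension σ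
    (fun ρ => Allowed i ρ ∧ ∀ v : List ℕ, blockOutput k ρ ≠ v.map some)
    (fun ρ s h => ⟨h.1.take s, fun v hv => h.2 v (blockOutput_of_take hv)⟩)
    (fun t => by
      obtain ⟨τ, hτ, hv⟩ := hno t
      obtain ⟨⟨hl, hτb⟩, hτa⟩ := mem_allowedAbove.1 hτ
      refine ⟨τ, ?_, fun a ha => (List.mem_append.1 ha).elim (hb a) (hτb a), hτa, hv⟩
      rw [hl, show k + 1 + t = k + (t + 1) by omega, pow_add,
        Nat.le_sub_iff_add_le (Nat.le_mul_of_pos_right _ (by positivity))]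
      have h1 := Nat.one_le_pow k 4 (by norm_num)
      have h2 : t + 1 + 1 ≤ 4 ^ (t + 1) := Nat.lt_pow_self (by norm_num)
      nlinarith)
  obtain ⟨h, hh⟩ := hcomp f ⟨hf, fun s => (hfp s).1⟩ (hσ ▸ hfσ)
  obtain ⟨s, hs⟩ := hh.exists_blockOutput
  exact (hfp s).2 _ hs

/-- No functional maps a nonempty part of one of the two classes into the other one. -/
theorem not_forall_computes_blockClass {i : ℕ} (hi : i < 2) (e s : ℕ) {g₀ : ℕ → ℕ}
    (hg₀ : g₀ ∈ blockClass i) : ¬ ∀ g ∈ blockClass i, initSeg g s = initSeg g₀ s →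
      ∃ h ∈ blockClass (1 - i), Computes e g h := by
  classical
  intro hall
  -- Block `k` diagonalises against `e`, has parity `1 - i`, and starts late enough for `σ` to
  -- determine the first `s` values.
  obtain ⟨k, hk⟩ : ∃ k, k = 2 * Nat.pair e s + (1 - i) := ⟨_, rfl⟩
  have hke : (k / 2).unpair.1 = e := by
    rw [show k / 2 = Nat.pair e s by omega, Nat.unpair_pair]
  have hks : s ≤ 4 ^ k := by
    have h1 := Nat.right_le_pair e s
    have h2 : k < 4 ^ k := Nat.lt_pow_self (by norm_num)
    omega
  have hkmod : k % 2 = 1 - i := by omega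
  have hki : k % 2 ≠ i := by omega
  obtain ⟨σ, hσdef⟩ : ∃ σ, σ = initSeg g₀ (4 ^ k) := ⟨_, rfl⟩
  have hσ : σ.length = 4 ^ k := by rw [hσdef, length_initSeg]
  have hb : ∀ a ∈ σ, a < 2 := hσdef ▸ forall_mem_initSeg hg₀.1 _
  have hσa : Allowed i σ := hσdef ▸ hg₀.2 _
  have hcomp : ∀ g ∈ blockClass i, initSeg g (4 ^ k) = σ →
      ∃ h ∈ blockClass (1 - i), Computes (k / 2).unpair.1 g h := by
    intro g hg hgσ
    rw [hke]
    refine hall g hg ?_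
    rw [← take_initSeg g hks, hgσ, hσdef, take_initSeg g₀ hks]
  have hcomp' : ∀ t, ∀ τ ∈ allowedAbove i k σ (k + 1 + t), ∀ v : List ℕ,
      blockOutput k (σ ++ τ) = v.map some → ∃ h ∈ blockClass (1 - i),
        v = (initSeg h (4 ^ (k + 1))).drop (4 ^ k) := by
    intro t τ hτ v hv
    obtain ⟨g, hg, hgσ, hgτ⟩ := exists_blockClass_extension (by omega) hσ hb hτ
    obtain ⟨h, hh, hgh⟩ := hcomp g hg hgσ
    exact ⟨h, hh, hgh.eq_of_blockOutput (hgτ ▸ hv)⟩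
  have hfreq : ∃ n, IsFrequent k σ n := by
    obtain ⟨t, ht⟩ := exists_length_blockOutput hσ hb fun g hg hgσ =>
      let ⟨h, _, hgh⟩ := hcomp g hg hgσ; ⟨h, hgh⟩
    choose! F hF using ht
    have hmaps : ∀ τ ∈ allowedAbove i k σ (k + 1 + t), F τ ∈ binFinset (3 * 4 ^ k) := by
      intro τ hτ
      obtain ⟨h, hh, hv⟩ := hcomp' t τ hτ _ (hF τ hτ)
      rw [mem_binFinset]
      refine ⟨(blockOutput_eq_map_some_iff.1 (hF τ hτ)).1, fun a ha => ?_⟩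
      rw [hv] at ha
      exact forall_mem_initSeg hh.1 _ a (List.mem_of_mem_drop ha)
    -- Pigeonhole over the `2 ^ (3 * 4 ^ k)` possible values of the block.
    obtain ⟨v, -, hv⟩ := Finset.exists_le_card_fiber_of_nsmul_le_card_of_maps_to
      (M := ℝ) (b := (allowedAbove i k σ (k + 1 + t)).card / 2 ^ (3 * 4 ^ k)) hmaps
      ⟨List.replicate (3 * 4 ^ k) 0, mem_binFinset.2 ⟨by simp, fun a ha => by
        rw [List.eq_of_mem_replicate ha]; norm_num⟩⟩ (by
        rw [card_binFinset, nsmul_eq_mul]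
        push_cast
        rw [mul_div_cancel₀ _ (by positivity)])
    refine ⟨Nat.pair t (Encodable.encode v), ?_⟩
    unfold IsFrequent
    rw [Nat.unpair_pair, listOfCode_encode, outputCount_eq_card]
    have hsub : ((allowedAbove i k σ (k + 1 + t)).filter fun τ => F τ = v).card ≤
        ((binFinset (4 ^ (k + 1 + t) - 4 ^ k)).filter
          fun τ => blockOutput k (σ ++ τ) = v.map some).card := by
      refine Finset.card_le_card fun τ hτF => ?_
      obtain ⟨hτ, hFτ⟩ := Finset.mem_filter.1 hτF
      exact Finset.mem_filter.2
        ⟨mem_binFinset.2 (mem_allowedAbove.1 hτ).1, hFτ ▸ hF τ hτ⟩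
    have hratio := le_card_allowedAbove_div hσ hσa hki t
    rw [le_div_iff₀ (by positivity)] at hratio
    rw [div_le_iff₀ (by positivity)] at hv
    -- At least half of all extensions are allowed; this accounts for the `+ 1` in the exponent of
    -- `IsFrequent`.
    have hhalf : (1 / 2 : ℝ) ^ (3 * 4 ^ k + 1) ≤ 1 / 2 := by
      rw [pow_succ]
      have : (1 / 2 : ℝ) ^ (3 * 4 ^ k) ≤ 1 := pow_le_one₀ (by norm_num) (by norm_num)
      linarith
    have hpos : (0 : ℝ) < (1 / 2) ^ 4 ^ (k + 1 + t) := by positivity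
    have hD : (0 : ℝ) < 2 ^ (4 ^ (k + 1 + t) - 4 ^ k) := by positivity
    have hbig : (1 / 2 : ℝ) * 2 ^ (4 ^ (k + 1 + t) - 4 ^ k) ≤
        (allowedAbove i k σ (k + 1 + t)).card :=
      (mul_le_mul_of_nonneg_right (by linarith) hD.le).trans hratio
    have hsub' : (((allowedAbove i k σ (k + 1 + t)).filter fun τ => F τ = v).card : ℝ) ≤
        ((binFinset (4 ^ (k + 1 + t) - 4 ^ k)).filter
          fun τ => blockOutput k (σ ++ τ) = v.map some).card := by exact_mod_cast hsub
    have hB : (0 : ℝ) < 2 ^ (3 * 4 ^ k) := by positivity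
    have hfin : (2 : ℝ) ^ (4 ^ (k + 1 + t) - 4 ^ k) ≤ 2 ^ (3 * 4 ^ k + 1) *
        ((binFinset (4 ^ (k + 1 + t) - 4 ^ k)).filter
          fun τ => blockOutput k (σ ++ τ) = v.map some).card := by
      have := mul_le_mul_of_nonneg_right hsub' hB.le
      rw [pow_succ]
      linarith
    exact_mod_cast hfin
  obtain ⟨n, hn, hmin⟩ : ∃ n, IsFrequent k σ n ∧ ∀ m < n, ¬ IsFrequent k σ m :=
    ⟨Nat.find hfreq, Nat.find_spec hfreq, fun m hm => Nat.find_min hfreq hm⟩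
  obtain ⟨v, hvdef⟩ : ∃ v, v = listOfCode n.unpair.2 := ⟨_, rfl⟩
  obtain ⟨t, htdef⟩ : ∃ t, t = n.unpair.1 := ⟨_, rfl⟩
  have hforb : IsForbidden k v :=
    ⟨σ, mem_binFinset.2 ⟨hσ, hb⟩, n, hn, hmin, hvdef.symm⟩
  unfold IsFrequent at hn
  rw [← hvdef, ← htdef, outputCount_eq_card] at hn
  -- The fractions of allowed extensions and of those producing `v` add up to more than one, so the
  -- two sets meet.
  obtain ⟨τ, hτ, hτv⟩ : ∃ τ ∈ allowedAbove i k σ (k + 1 + t),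
      blockOutput k (σ ++ τ) = v.map some := by
    by_contra! hno
    have hdisj : Disjoint (allowedAbove i k σ (k + 1 + t))
        ((binFinset (4 ^ (k + 1 + t) - 4 ^ k)).filter
          fun τ => blockOutput k (σ ++ τ) = v.map some) :=
      Finset.disjoint_left.2 fun τ hτ hτ' => hno τ hτ (Finset.mem_filter.1 hτ').2
    have hcard := Finset.card_union_of_disjoint hdisj
    have hle := Finset.card_le_card (Finset.union_subset
      (Finset.filter_subset (fun τ => Allowed i (σ ++ τ)) (binFinset (4 ^ (k + 1 + t) - 4 ^ k)))
      (Finset.filter_subset (fun τ => blockOutput k (σ ++ τ) = v.map some) _))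
    rw [card_binFinset] at hle
    change (allowedAbove i k σ (k + 1 + t) ∪ _).card ≤ _ at hle
    rw [hcard] at hle
    have hratio := le_card_allowedAbove_div hσ hσa hki t
    rw [le_div_iff₀ (by positivity)] at hratio
    generalize ((binFinset (4 ^ (k + 1 + t) - 4 ^ k)).filter
      fun τ => blockOutput k (σ ++ τ) = v.map some).card = c at hn hle
    generalize (allowedAbove i k σ (k + 1 + t)).card = a at hle hratio
    have hn' : (2 : ℝ) ^ (4 ^ (k + 1 + t) - 4 ^ k) ≤ 2 ^ (3 * 4 ^ k + 1) * c := by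
      exact_mod_cast hn
    have hle' : (a + c : ℝ) ≤ 2 ^ (4 ^ (k + 1 + t) - 4 ^ k) := by exact_mod_cast hle
    have hB : (0 : ℝ) < (1 / 2) ^ (3 * 4 ^ k + 1) := by positivity
    have hBB : (1 / 2 : ℝ) ^ (3 * 4 ^ k + 1) * 2 ^ (3 * 4 ^ k + 1) = 1 := by
      rw [← mul_pow]; norm_num
    have hpos : (0 : ℝ) < (1 / 2) ^ 4 ^ (k + 1 + t) * 2 ^ (4 ^ (k + 1 + t) - 4 ^ k) := by
      positivity
    have hc := mul_le_mul_of_nonneg_left hn' hB.le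
    rw [← mul_assoc, hBB, one_mul] at hc
    nlinarith
  obtain ⟨h, hh, hv⟩ := hcomp' t τ hτ v hτv
  refine hh.2 (4 ^ (k + 1)) k hkmod (by rw [length_initSeg]) ?_
  rw [take_initSeg h le_rfl, ← hv]
  exact hforb

/-! ### Sequences written on two tapes -/

/-- The bits written on tape `i` by the first `m` pairs of `x`, where the pair
`x (2 * j), x (2 * j + 1)` writes the bit `x (2 * j + 1)` on the tape `x (2 * j)`. -/
def tape (i : ℕ) (x : ℕ → ℕ) (m : ℕ) : List ℕ :=
  ((List.range m).filter fun j => x (2 * j) = i).map fun j => x (2 * j + 1)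

theorem tape_succ (i : ℕ) (x : ℕ → ℕ) (m : ℕ) :
    tape i x (m + 1) = tape i x m ++ if x (2 * m) = i then [x (2 * m + 1)] else [] := by
  unfold tape
  rw [List.range_succ, List.filter_append, List.map_append]
  split_ifs with h <;> simp [h]

theorem tape_congr {i m : ℕ} {x y : ℕ → ℕ} (h : ∀ n < 2 * m, x n = y n) :
    tape i x m = tape i y m := by
  induction m with
  | zero => rfl
  | succ m ih =>
    rw [tape_succ, tape_succ, ih fun n hn => h n (by omega), h (2 * m) (by omega),
      h (2 * m + 1) (by omega)]

theorem tape_prefix (i : ℕ) (x : ℕ → ℕ) {m m' : ℕ} (h : m ≤ m') :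
    tape i x m <+: tape i x m' := by
  induction m', h using Nat.le_induction with
  | base => exact List.prefix_rfl
  | succ m' _ ih => exact ih.trans (tape_succ i x m' ▸ List.prefix_append _ _)

theorem forall_mem_tape {x : ℕ → ℕ} (hx : ∀ n, x n < 2) (i m : ℕ) : ∀ a ∈ tape i x m, a < 2 := by
  intro a ha
  obtain ⟨j, _, rfl⟩ := List.mem_map.1 ha
  exact hx _

theorem length_tape_add {x : ℕ → ℕ} (hx : ∀ n, x n < 2) (m : ℕ) :
    (tape 0 x m).length + (tape 1 x m).length = m := by
  induction m with
  | zero => rfl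
  | succ m ih =>
    rw [tape_succ, tape_succ, List.length_append, List.length_append]
    have := hx (2 * m)
    rcases (by omega : x (2 * m) = 0 ∨ x (2 * m) = 1) with h | h <;> simp [h] <;> omega

theorem Allowed.of_prefix {i : ℕ} {σ τ : List ℕ} (h : Allowed i τ) (hσ : σ <+: τ) :
    Allowed i σ := by
  rw [List.prefix_iff_eq_take.1 hσ]
  exact h.take _

/-- The first block is `[1, 4)`; position `0` lies in no block. -/
theorem allowed_of_length_lt {i : ℕ} {τ : List ℕ} (h : τ.length < 4) : Allowed i τ := by
  intro k _ hl
  have := Nat.one_le_pow k 4 (by norm_num)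
  rw [pow_succ] at hl
  omega

/-- The binary sequences for which the contents of tape `i` belongs to the class with number `i`
as far as it goes. -/
def twoTape : Set (ℕ → ℕ) :=
  {x | (∀ n, x n < 2) ∧ ∀ m, ∀ i < 2, Allowed i (tape i x m)}

/-- The members of `twoTape` that use a single tape. -/
def oneTape : Set (ℕ → ℕ) :=
  {x | x ∈ twoTape ∧ ∀ j, x (2 * j) = x 0}

/-- The contents of tape `i` as written by a finite sequence. -/
def tapeOfList (i : ℕ) (τ : List ℕ) : List ℕ :=
  tape i (fun n => τ.getD n 0) (τ.length / 2)

theorem tapeOfList_initSeg (i : ℕ) (x : ℕ → ℕ) (s : ℕ) :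
    tapeOfList i (initSeg x s) = tape i x (s / 2) := by
  unfold tapeOfList
  rw [length_initSeg]
  exact tape_congr fun n hn => getD_initSeg x (by omega)

theorem primrec_tapeOfList : Primrec₂ tapeOfList := by
  have hR : PrimrecRel fun (j : ℕ) (p : ℕ × List ℕ) => p.2.getD (2 * j) 0 = p.1 :=
    Primrec.eq.comp ((Primrec.list_getD 0).comp (Primrec.snd.comp Primrec.snd)
      (Primrec.nat_double.comp Primrec.fst)) (Primrec.fst.comp Primrec.snd)
  have hlen : Primrec fun p : ℕ × List ℕ => List.range (p.2.length / 2) :=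
    Primrec.list_range.comp (Primrec.nat_div.comp (Primrec.list_length.comp Primrec.snd)
      (Primrec.const 2))
  have hfilter := hR.listFilter.comp hlen Primrec.id
  exact Primrec.list_map hfilter ((Primrec.list_getD 0).comp (Primrec.snd.comp Primrec.fst)
    (Primrec.nat_double_succ.comp Primrec.snd))

/-- The number `w` codes a proof that `τ` writes a forbidden block on one of the tapes. -/
def WritesForbidden (p : List ℕ × ℕ) : Prop :=
  4 ^ (p.2.unpair.1 + 1) ≤ (tapeOfList (p.2.unpair.1 % 2) p.1).length ∧
  ((listOfCode p.2.unpair.2.unpair.1).length = 4 ^ p.2.unpair.1 ∧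
    ∀ a ∈ listOfCode p.2.unpair.2.unpair.1, a < 2) ∧
  IsSelectedBy p.2.unpair.1 (listOfCode p.2.unpair.2.unpair.1)
    (((tapeOfList (p.2.unpair.1 % 2) p.1).take (4 ^ (p.2.unpair.1 + 1))).drop
      (4 ^ p.2.unpair.1)) p.2.unpair.2.unpair.2

theorem primrecPred_writesForbidden : PrimrecPred WritesForbidden := by
  have hk : Primrec fun p : List ℕ × ℕ => p.2.unpair.1 :=
    Primrec.fst.comp (Primrec.unpair.comp Primrec.snd)
  have hu : Primrec fun p : List ℕ × ℕ => p.2.unpair.2.unpair :=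
    Primrec.unpair.comp (Primrec.snd.comp (Primrec.unpair.comp Primrec.snd))
  have hσ : Primrec fun p : List ℕ × ℕ => listOfCode p.2.unpair.2.unpair.1 :=
    primrec_listOfCode.comp (Primrec.fst.comp hu)
  have hρ : Primrec fun p : List ℕ × ℕ => tapeOfList (p.2.unpair.1 % 2) p.1 :=
    primrec_tapeOfList.comp (Primrec.nat_mod.comp hk (Primrec.const 2)) Primrec.fst
  have hpow : Primrec fun p : List ℕ × ℕ => 4 ^ p.2.unpair.1 := primrec_pow (Primrec.const 4) hk
  have hpow' : Primrec fun p : List ℕ × ℕ => 4 ^ (p.2.unpair.1 + 1) :=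
    primrec_pow (Primrec.const 4) (Primrec.succ.comp hk)
  have hbin : PrimrecPred fun l : List ℕ => ∀ a ∈ l, a < 2 :=
    (Primrec.nat_lt.comp Primrec.id (Primrec.const 2)).forall_mem_list
  have hblock := Primrec.list_drop.comp hpow (Primrec.list_take.comp hpow' hρ)
  have hsel := primrecPred_isSelectedBy.comp
    ((hk.pair hσ).pair (hblock.pair (Primrec.snd.comp hu)))
  exact (Primrec.nat_le.comp hpow' (Primrec.list_length.comp hρ)).and
    (((Primrec.eq.comp (Primrec.list_length.comp hσ) hpow).and (hbin.comp hσ)).and hsel)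

theorem forall_allowed_iff (x : ℕ → ℕ) : (∀ m, ∀ i < 2, Allowed i (tape i x m)) ↔
    ∀ s w, ¬ WritesForbidden (initSeg x s, w) := by
  simp only [WritesForbidden, tapeOfList_initSeg]
  constructor
  · rintro h s w ⟨hl, hσ, hsel⟩
    exact h (s / 2) _ (Nat.mod_lt _ (by norm_num)) _ rfl hl
      ⟨_, mem_binFinset.2 hσ, _, hsel⟩
  · rintro h m i - k rfl hl ⟨σ, hσ, n, hsel⟩
    refine h (2 * m) (Nat.pair k (Nat.pair (Encodable.encode σ) n)) ?_
    simp only [Nat.unpair_pair, listOfCode_encode]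
    rw [Nat.mul_div_cancel_left m (by norm_num)]
    exact ⟨hl, mem_binFinset.1 hσ, hsel⟩

/-! ### Both tape classes are effectively closed -/

theorem isPi01Cantor_twoTape : IsPi01Cantor twoTape := by
  convert isPi01Cantor_of_primrecPred _ primrecPred_writesForbidden using 1
  ext x
  exact and_congr_right fun _ => forall_allowed_iff x

theorem isPi01Cantor_oneTape : IsPi01Cantor oneTape := by
  -- The same witness serves as the code of a forbidden block or as the index of a pair that changes
  -- tapes.
  have hB : PrimrecPred fun p : List ℕ × ℕ => WritesForbidden p ∨
      (2 * p.2 < p.1.length ∧ ¬ p.1.getD (2 * p.2) 0 = p.1.getD 0 0) := by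
    have hd : Primrec fun p : List ℕ × ℕ => 2 * p.2 := Primrec.nat_double.comp Primrec.snd
    refine primrecPred_writesForbidden.or (PrimrecPred.and ?_ (PrimrecPred.not ?_))
    · exact Primrec.nat_lt.comp hd (Primrec.list_length.comp Primrec.fst)
    · exact Primrec.eq.comp ((Primrec.list_getD 0).comp Primrec.fst hd)
        ((Primrec.list_getD 0).comp Primrec.fst (Primrec.const 0))
  convert isPi01Cantor_of_primrecPred _ hB using 1
  ext x
  simp only [oneTape, twoTape, Set.mem_ofPred_eq, and_assoc, forall_allowed_iff]
  refine and_congr_right fun _ => ?_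
  constructor
  · rintro ⟨h₁, h₂⟩ s w (h | ⟨hl, hne⟩)
    · exact h₁ s w h
    · rw [length_initSeg] at hl
      rw [getD_initSeg x hl, getD_initSeg x (by omega)] at hne
      exact hne (h₂ w)
  · refine fun h => ⟨fun s w hw => h s w (Or.inl hw), fun j => ?_⟩
    by_contra hne
    refine h (2 * j + 1) j (Or.inr ⟨by simp, ?_⟩)
    rwa [getD_initSeg x (by omega), getD_initSeg x (by omega)]

/-! ### Writing a sequence on one of the tapes -/

/-- The sequence that starts with the first `m` pairs of `x` and then writes
`f c, f (c + 1), …` on tape `i`. -/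
def writeOn (i : ℕ) (x : ℕ → ℕ) (m c : ℕ) (f : ℕ → ℕ) (n : ℕ) : ℕ :=
  if n < 2 * m then x n else if n % 2 = 0 then i else f (c + (n - 2 * m) / 2)

theorem writeOn_of_lt {i m c n : ℕ} {x f : ℕ → ℕ} (h : n < 2 * m) :
    writeOn i x m c f n = x n := if_pos h

theorem writeOn_even (i m c t : ℕ) (x f : ℕ → ℕ) : writeOn i x m c f (2 * (m + t)) = i := by
  rw [writeOn, if_neg (by omega), if_pos (by omega)]

theorem writeOn_odd (i m c t : ℕ) (x f : ℕ → ℕ) :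
    writeOn i x m c f (2 * (m + t) + 1) = f (c + t) := by
  rw [writeOn, if_neg (by omega), if_neg (by omega)]
  congr 2
  omega

theorem tape_writeOn_self {i m c : ℕ} {x f : ℕ → ℕ} (h : tape i x m = initSeg f c) (t : ℕ) :
    tape i (writeOn i x m c f) (m + t) = initSeg f (c + t) := by
  induction t with
  | zero => exact (tape_congr fun n hn => writeOn_of_lt hn).trans h
  | succ t ih =>
    rw [← Nat.add_assoc, tape_succ, ih, writeOn_even, if_pos rfl, writeOn_odd, ← Nat.add_assoc,
      initSeg_succ]

theorem tape_writeOn_ne {i i' m c : ℕ} {x f : ℕ → ℕ} (h : i ≠ i') (t : ℕ) :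
    tape i' (writeOn i x m c f) (m + t) = tape i' x m := by
  induction t with
  | zero => exact tape_congr fun n hn => writeOn_of_lt hn
  | succ t ih => rw [← Nat.add_assoc, tape_succ, ih, writeOn_even, if_neg h, List.append_nil]

theorem writeOn_lt_two {i m c : ℕ} {x f : ℕ → ℕ} (hi : i < 2) (hx : ∀ n, x n < 2)
    (hf : ∀ n, f n < 2) (n : ℕ) : writeOn i x m c f n < 2 := by
  unfold writeOn
  split_ifs
  exacts [hx n, hi, hf _]

theorem writeOn_mem_twoTape {i m c : ℕ} {x f : ℕ → ℕ} (hi : i < 2) (hx : ∀ n, x n < 2)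
    (ha : ∀ i < 2, Allowed i (tape i x m)) (hf : f ∈ blockClass i)
    (h : tape i x m = initSeg f c) : writeOn i x m c f ∈ twoTape := by
  refine ⟨writeOn_lt_two hi hx hf.1, fun m' i' hi' => ?_⟩
  refine Allowed.of_prefix ?_ (tape_prefix i' _ (Nat.le_add_left m' m))
  by_cases hii : i = i'
  · subst hii
    rw [tape_writeOn_self h]
    exact hf.2 _
  · rw [tape_writeOn_ne hii]
    exact ha i' hi'

/-! ### Reductions between the two classes -/

theorem reducibleVia_finitelyComputable {P Q : Set (ℕ → ℕ)} (b : ℕ)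
    (h : ∀ g ∈ Q, ∃ e < b, ∃ f ∈ P, Computes e g f) : ReducibleVia finitelyComputable P Q := by
  choose e he F hF hc using h
  exact ⟨fun g => ⟨g ∈ Q, fun hg => F g hg⟩,
    ⟨b, fun g hg => ⟨e g hg, he g hg, F g hg, ⟨hg, rfl⟩, hc g hg⟩⟩,
    fun g hg => ⟨F g hg, ⟨hg, rfl⟩, hF g hg⟩⟩

theorem reducibleVia_learnable {P Q : Set (ℕ → ℕ)} (e : ℕ)
    (h : ∀ g ∈ Q, ∃ f ∈ P, Computes e g f) : ReducibleVia learnable P Q := by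
  choose F hF hc using h
  exact ⟨fun g => ⟨g ∈ Q, fun hg => F g hg⟩, ⟨fun _ => e, Computable.const e,
    fun g hg => ⟨e, ⟨0, fun _ _ => rfl⟩, F g hg, ⟨hg, rfl⟩, hc g hg⟩⟩,
    fun g hg => ⟨F g hg, ⟨hg, rfl⟩, hF g hg⟩⟩

/-- Each index `e < b` becomes a constant learner. -/
theorem finitelyComputable_subset_teamLearnable : finitelyComputable ⊆ teamLearnable := by
  rintro Γ ⟨b, hb⟩
  refine ⟨b, fun i _ => i, fun i => Computable.const _, fun g hg => ?_⟩
  obtain ⟨e, he, h⟩ := hb g hg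
  exact ⟨⟨e, he⟩, e, ⟨0, fun _ _ => rfl⟩, h⟩

theorem ReducibleVia.mono {𝓕 𝓖 : Set ((ℕ → ℕ) →. (ℕ → ℕ))} (h : 𝓕 ⊆ 𝓖) {P Q : Set (ℕ → ℕ)}
    (hPQ : ReducibleVia 𝓕 P Q) : ReducibleVia 𝓖 P Q :=
  let ⟨Γ, hΓ, hg⟩ := hPQ; ⟨Γ, h hΓ, hg⟩

theorem exists_computes_self : ∃ e, ∀ g : ℕ → ℕ, Computes e g g := by
  obtain ⟨e, he⟩ := exists_computes (fun τ n => τ[n]?) Primrec.list_getElem?.to_comp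
  refine ⟨e, fun g => he g g (fun n s t a hst h => ?_) fun n => ⟨n + 1, by simp [initSeg]⟩⟩
  rw [← take_initSeg g hst, List.getElem?_take] at h
  split_ifs at h
  exact h

/-- The finite contents form a chain of prefixes, so unbounded length yields a limit sequence. -/
theorem exists_tape_eq_initSeg {i : ℕ} {x : ℕ → ℕ}
    (h : ∀ N, ∃ m, N < (tape i x m).length) :
    ∃ f, ∀ m, tape i x m = initSeg f (tape i x m).length := by
  choose M hM using h
  refine ⟨fun j => (tape i x (M j)).getD j 0, fun m => ?_⟩
  nth_rw 1 [← initSeg_getD (tape i x m)]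
  refine initSeg_congr fun j hj => ?_
  rcases le_total m (M j) with hle | hle
  · obtain ⟨ρ, hρ⟩ := tape_prefix i x hle
    rw [← hρ, List.getD_append _ _ _ _ hj]
  · obtain ⟨ρ, hρ⟩ := tape_prefix i x hle
    rw [← hρ, List.getD_append _ _ _ _ (hM j)]

theorem exists_computes_tape (i : ℕ) : ∃ e, ∀ x f : ℕ → ℕ,
    (∀ N, ∃ m, N < (tape i x m).length) →
    (∀ m, tape i x m = initSeg f (tape i x m).length) →
    Computes e x (writeOn i x 0 0 f) := by
  have hF : Computable₂ fun (τ : List ℕ) (n : ℕ) =>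
      if n % 2 = 0 then some i else (tapeOfList i τ)[n / 2]? := by
    refine Primrec.to_comp (Primrec.ite ?_ (Primrec.const _) ?_)
    · exact Primrec.eq.comp (Primrec.nat_mod.comp Primrec.snd (Primrec.const 2))
        (Primrec.const 0)
    · exact Primrec.list_getElem?.comp
        (primrec_tapeOfList.comp (Primrec.const i) Primrec.fst)
        (Primrec.nat_div.comp Primrec.snd (Primrec.const 2))
  obtain ⟨e, he⟩ := exists_computes _ hF
  refine ⟨e, fun x f hlong hf => he x _ (fun n s t a hst h => ?_) fun n => ?_⟩
  · simp only [tapeOfList_initSeg] at h ⊢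
    split_ifs at h ⊢ with hn
    · exact h
    · obtain ⟨ρ, hρ⟩ := tape_prefix i x (Nat.div_le_div_right (c := 2) hst)
      obtain ⟨hlt, -⟩ := List.getElem?_eq_some_iff.1 h
      rw [← hρ, List.getElem?_append_left hlt, h]
  · obtain ⟨m, hm⟩ := hlong (n / 2)
    refine ⟨2 * m, ?_⟩
    simp only [tapeOfList_initSeg, writeOn, Nat.not_lt_zero, mul_zero, if_false]
    split_ifs with hn
    · rfl
    · rw [Nat.mul_div_cancel_left m (by norm_num), hf m]
      simp [initSeg, hm]

theorem writeOn_zero_mem_oneTape {i : ℕ} (hi : i < 2) {x f : ℕ → ℕ} (hx : ∀ n, x n < 2)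
    (hf : f ∈ blockClass i) : writeOn i x 0 0 f ∈ oneTape := by
  refine ⟨writeOn_mem_twoTape hi hx
    (fun i _ => allowed_of_length_lt (by simp [tape])) hf rfl, fun j => ?_⟩
  have h := writeOn_even i 0 0 j x f
  have h₀ := writeOn_even i 0 0 0 x f
  rw [Nat.zero_add] at h
  exact h.trans h₀.symm

theorem twoTape_reducible_oneTape :
    ReducibleVia finitelyComputable twoTape oneTape ∧ ReducibleVia learnable twoTape oneTape := by
  obtain ⟨e, he⟩ := exists_computes_self
  exact ⟨reducibleVia_finitelyComputable (e + 1) fun g hg =>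
      ⟨e, Nat.lt_succ_self e, g, hg.1, he g⟩,
    reducibleVia_learnable e fun g hg => ⟨g, hg.1, he g⟩⟩

theorem oneTape_reducible_twoTape : ReducibleVia finitelyComputable oneTape twoTape := by
  choose e he using exists_computes_tape
  refine reducibleVia_finitelyComputable (max (e 0) (e 1) + 1) fun x hx => ?_
  have key : ∀ i < 2, (∀ N, ∃ m, N < (tape i x m).length) →
      ∃ f ∈ oneTape, Computes (e i) x f := by
    intro i hi hlong
    obtain ⟨f, hf⟩ := exists_tape_eq_initSeg hlong
    refine ⟨_, writeOn_zero_mem_oneTape hi hx.1 ⟨fun n => ?_, fun s => ?_⟩, he i x f hlong hf⟩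
    · obtain ⟨m, hm⟩ := hlong n
      refine forall_mem_tape hx.1 i m _ ?_
      rw [hf m]
      exact List.mem_map_of_mem (List.mem_range.2 hm)
    · obtain ⟨m, hm⟩ := hlong s
      have h := (hx.2 m i hi).take s
      rwa [hf m, take_initSeg f hm.le] at h
  by_cases h₀ : ∀ N, ∃ m, N < (tape 0 x m).length
  · exact ⟨e 0, Nat.lt_succ_of_le (le_max_left _ _), key 0 (by norm_num) h₀⟩
  · refine ⟨e 1, Nat.lt_succ_of_le (le_max_right _ _), key 1 (by norm_num) fun N => ?_⟩
    push Not at h₀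
    obtain ⟨N₀, hN₀⟩ := h₀
    -- Every pair writes on exactly one tape. If tape 0 never exceeds `N₀` bits, tape 1 has received
    -- more than `N` by this time.
    refine ⟨N₀ + N + 1, ?_⟩
    have h₁ := length_tape_add hx.1 (N₀ + N + 1)
    have h₂ := hN₀ (N₀ + N + 1)
    omega

/-! ### Failure of learnability -/

/-- After `m` pairs of `x`, both tapes contain complete blocks none of which is forbidden. -/
def IsCondition (x : ℕ → ℕ) (m : ℕ) : Prop :=
  (∀ n, x n < 2) ∧ ∀ i < 2, (∃ k, (tape i x m).length = 4 ^ k) ∧ Allowed i (tape i x m)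

theorem IsCondition.exists_mem {x : ℕ → ℕ} {m i : ℕ} (h : IsCondition x m) (hi : i < 2) :
    ∃ f ∈ blockClass i, tape i x m = initSeg f (tape i x m).length := by
  obtain ⟨⟨k, hk⟩, ha⟩ := h.2 i hi
  obtain ⟨f, hf, hfx⟩ := exists_mem_blockClass hk (forall_mem_tape h.1 i m) ha
  exact ⟨f, hf, by rw [hk, hfx]⟩

theorem IsCondition.mem_twoTape {x f : ℕ → ℕ} {m i c : ℕ} (h : IsCondition x m) (hi : i < 2)
    (hf : f ∈ blockClass i) (hfx : tape i x m = initSeg f c) :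
    writeOn i x m c f ∈ twoTape :=
  writeOn_mem_twoTape hi h.1 (fun i hi => (h.2 i hi).2) hf hfx

theorem IsCondition.exists_extension {x f : ℕ → ℕ} {m i c : ℕ} (h : IsCondition x m)
    (hi : i < 2) (hf : f ∈ blockClass i) (hfx : tape i x m = initSeg f c) (t : ℕ) :
    ∃ m', m + t ≤ m' ∧ IsCondition (writeOn i x m c f) m' := by
  obtain ⟨⟨k, hk⟩, ha⟩ := h.2 i hi
  have hc : c = 4 ^ k := by rw [← hk, hfx, length_initSeg]
  have h1 := Nat.one_le_pow k 4 (by norm_num)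
  have h2 : t + 1 ≤ 4 ^ t := Nat.lt_pow_self (by norm_num)
  have h3 : c + t ≤ 4 ^ (k + t) := by rw [hc, pow_add]; nlinarith
  refine ⟨m + (4 ^ (k + t) - c), by omega, writeOn_lt_two hi h.1 hf.1, fun i' hi' => ?_⟩
  by_cases hii : i = i'
  · subst hii
    rw [tape_writeOn_self hfx]
    exact ⟨⟨k + t, by rw [length_initSeg]; omega⟩, hf.2 _⟩
  · rw [tape_writeOn_ne hii]
    exact h.2 i' hi'

theorem exists_isCondition : ∃ x m, IsCondition x m := by
  -- The pairs `(0, 0)` and `(1, 0)` put one bit on each tape, and `1 = 4 ^ 0`.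
  refine ⟨fun n => if n = 2 then 1 else 0, 2, fun n => ?_, fun i hi => ?_⟩
  · dsimp only
    split_ifs <;> norm_num
  · have : (tape i (fun n => if n = 2 then 1 else 0) 2).length = 1 := by
      interval_cases i <;> rfl
    exact ⟨⟨0, this⟩, allowed_of_length_lt (by omega)⟩

/-- The learner `Ψ` never changes its mind along sequences that extend the condition `x, m` and
use a single tape from some further condition on. -/
def Locks (Ψ : List ℕ → ℕ) (x : ℕ → ℕ) (m : ℕ) : Prop :=
  ∀ y m', IsCondition y m' → m ≤ m' → (∀ n < 2 * m, y n = x n) →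
    ∀ i < 2, ∀ f ∈ blockClass i, ∀ c, tape i y m' = initSeg f c →
      ∀ s, 2 * m ≤ s → Ψ (initSeg (writeOn i y m' c f) s) = Ψ (initSeg x (2 * m))

/-- A failure of locking appears at a finite stage `s`; writing on past `s` to a block boundary
restores a condition. -/
theorem exists_mind_change {Ψ : List ℕ → ℕ} {x : ℕ → ℕ} {m : ℕ} (h : ¬ Locks Ψ x m) :
    ∃ z m', IsCondition z m' ∧ m < m' ∧ (∀ n < 2 * m, z n = x n) ∧
      ∃ s, 2 * m ≤ s ∧ s ≤ 2 * m' ∧ Ψ (initSeg z s) ≠ Ψ (initSeg x (2 * m)) := by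
  unfold Locks at h
  push Not at h
  obtain ⟨y, m', hy, hm, hyx, i, hi, f, hf, c, hfy, s, hs, hne⟩ := h
  obtain ⟨m'', hm'', hcond⟩ := hy.exists_extension hi hf hfy (s + 1)
  refine ⟨_, m'', hcond, by omega, fun n hn => ?_, s, hs, by omega, hne⟩
  rw [writeOn_of_lt (by omega), hyx n hn]

theorem exists_locks {Ψ : List ℕ → ℕ}
    (hΨ : ∀ x ∈ twoTape, ∃ e N, ∀ n, N ≤ n → Ψ (initSeg x n) = e) :
    ∃ x m, IsCondition x m ∧ Locks Ψ x m := by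
  by_contra! hno
  have hstep : ∀ p : {p : (ℕ → ℕ) × ℕ // IsCondition p.1 p.2},
      ∃ q : {p : (ℕ → ℕ) × ℕ // IsCondition p.1 p.2}, p.1.2 < q.1.2 ∧
        (∀ n < 2 * p.1.2, q.1.1 n = p.1.1 n) ∧ ∃ s, 2 * p.1.2 ≤ s ∧ s ≤ 2 * q.1.2 ∧
          Ψ (initSeg q.1.1 s) ≠ Ψ (initSeg p.1.1 (2 * p.1.2)) := by
    rintro ⟨⟨x, m⟩, h⟩
    obtain ⟨z, m', hz, h'⟩ := exists_mind_change (hno x m h)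
    exact ⟨⟨⟨z, m'⟩, hz⟩, h'⟩
  choose next hlt hagree hchange using hstep
  obtain ⟨x₀, m₀, h₀⟩ := exists_isCondition
  let a : ℕ → {p : (ℕ → ℕ) × ℕ // IsCondition p.1 p.2} := fun n =>
    Nat.rec ⟨⟨x₀, m₀⟩, h₀⟩ (fun _ p => next p) n
  have ha : ∀ n, a (n + 1) = next (a n) := fun n => rfl
  have hmono : StrictMono fun n => (a n).1.2 :=
    strictMono_nat_of_lt_succ fun n => by rw [ha]; exact hlt (a n)
  have hage : ∀ n t, ∀ j < 2 * (a n).1.2, (a (n + t)).1.1 j = (a n).1.1 j := by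
    intro n t
    induction t with
    | zero => exact fun j _ => rfl
    | succ t ih =>
      intro j hj
      rw [← ih j hj, ← Nat.add_assoc, ha]
      exact hagree _ j (hj.trans_le
        (Nat.mul_le_mul_left 2 (hmono.monotone (Nat.le_add_right n t))))
  -- The `j + 1`-st condition fixes at least `2 * (j + 1)` entries, so it decides entry `j` of the
  -- limit.
  obtain ⟨X, hX⟩ : ∃ X : ℕ → ℕ, ∀ j, X j = (a (j + 1)).1.1 j := ⟨_, fun _ => rfl⟩
  have hXa : ∀ n, ∀ j < 2 * (a n).1.2, X j = (a n).1.1 j := by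
    intro n j hj
    rw [hX]
    rcases le_total n (j + 1) with hle | hle
    · obtain ⟨t, ht⟩ := Nat.exists_eq_add_of_le hle
      rw [ht, hage n t j hj]
    · obtain ⟨t, ht⟩ := Nat.exists_eq_add_of_le hle
      have : j + 1 ≤ (a (j + 1)).1.2 := hmono.le_apply
      rw [ht, hage (j + 1) t j (by omega)]
  have hXmem : X ∈ twoTape := by
    refine ⟨fun n => hX n ▸ (a (n + 1)).2.1 n, fun m i hi => ?_⟩
    have hm : m ≤ (a m).1.2 := hmono.le_apply
    rw [tape_congr fun n hn => hXa m n (by omega)]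
    exact ((a m).2.2 i hi).2.of_prefix (tape_prefix i _ hm)
  obtain ⟨e, N, hN⟩ := hΨ X hXmem
  -- This mind change happens at or beyond `N`, within the part already fixed for `X`.
  obtain ⟨s, hs, hs', hne⟩ := hchange (a N)
  have hm : N ≤ (a N).1.2 := hmono.le_apply
  rw [← ha] at hs' hne
  rw [← initSeg_congr fun j hj => hXa N j hj,
    ← initSeg_congr fun j hj => hXa (N + 1) j (by omega)] at hne
  exact hne ((hN s (by omega)).trans (hN _ (by omega)).symm)

/-! ### Pulling functionals back along `writeOn`, and defeating the learner -/

/-- The initial segment of `writeOn i y m c g` that is determined by the part `τ` of `g`, where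
`p` consists of the first `m` pairs of `y`. -/
def writeList (i : ℕ) (p : List ℕ) (m c : ℕ) (τ : List ℕ) : List ℕ :=
  (List.range (2 * m + 2 * (τ.length - c))).map
    (writeOn i (fun n => p.getD n 0) m c fun n => τ.getD n 0)

theorem writeList_initSeg (i m c s : ℕ) (y g : ℕ → ℕ) :
    writeList i (initSeg y (2 * m)) m c (initSeg g s) =
      initSeg (writeOn i y m c g) (2 * m + 2 * (s - c)) := by
  unfold writeList
  rw [length_initSeg]
  refine List.map_congr_left fun n hn => ?_
  rw [List.mem_range] at hn
  unfold writeOn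
  split_ifs with h₁ h₂
  · exact getD_initSeg y h₁
  · rfl
  · exact getD_initSeg g (by omega)

theorem primrec_writeList (i : ℕ) (p : List ℕ) (m c : ℕ) : Primrec (writeList i p m c) := by
  have hlen : Primrec fun τ : List ℕ => 2 * m + 2 * (τ.length - c) :=
    Primrec.nat_add.comp (Primrec.const _) (Primrec.nat_double.comp
      (Primrec.nat_sub.comp Primrec.list_length (Primrec.const c)))
  refine Primrec.list_map (Primrec.list_range.comp hlen) ?_
  refine Primrec.ite (Primrec.nat_lt.comp Primrec.snd (Primrec.const _))
    ((Primrec.list_getD 0).comp (Primrec.const p) Primrec.snd)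
    (Primrec.ite (Primrec.eq.comp (Primrec.nat_mod.comp Primrec.snd (Primrec.const 2))
      (Primrec.const 0)) (Primrec.const i) ?_)
  exact (Primrec.list_getD 0).comp Primrec.fst (Primrec.nat_add.comp (Primrec.const c)
    (Primrec.nat_div.comp (Primrec.nat_sub.comp Primrec.snd (Primrec.const _))
      (Primrec.const 2)))

theorem exists_computes_odd_writeOn (e i m c : ℕ) (y : ℕ → ℕ) :
    ∃ e', ∀ g h : ℕ → ℕ, Computes e (writeOn i y m c g) h →
      Computes e' g fun n => h (2 * n + 1) := by
  have hF : Computable₂ fun (τ : List ℕ) (n : ℕ) =>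
      approxValue e (writeList i (initSeg y (2 * m)) m c τ) (2 * n + 1) := by
    have h := primrec_approxValue.comp ((Primrec.const e).pair
      (((primrec_writeList i (initSeg y (2 * m)) m c).comp Primrec.fst).pair
        (Primrec.nat_double_succ.comp Primrec.snd)) : Primrec fun q : List ℕ × ℕ => _)
    exact h.to_comp
  obtain ⟨e', he'⟩ := exists_computes _ hF
  refine ⟨e', fun g h hgh => he' g _ (fun n s t a hst => ?_) fun n => ?_⟩
  · rw [writeList_initSeg, writeList_initSeg]
    exact approxValue_initSeg_mono (by omega)
  · obtain ⟨s, hs⟩ := (mem_turingFunctional_iff _ _ _ _).1 (hgh (2 * n + 1))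
    refine ⟨s + c, ?_⟩
    rw [writeList_initSeg]
    exact approxValue_initSeg_mono (by omega) hs

theorem odd_mem_blockClass {i : ℕ} (hi : i < 2) {h : ℕ → ℕ} (hh : h ∈ oneTape) (h0 : h 0 = i) :
    (fun n => h (2 * n + 1)) ∈ blockClass i := by
  have htape : ∀ m, tape i h m = initSeg (fun n => h (2 * n + 1)) m := by
    intro m
    induction m with
    | zero => rfl
    | succ m ih => rw [tape_succ, ih, if_pos ((hh.2 m).trans h0), initSeg_succ]
  exact ⟨fun n => hh.1.1 _, fun s => htape s ▸ hh.1.2 s i hi⟩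

/-- If every output declared tape `1 - i`, its odd entries would lie in `blockClass (1 - i)`, and
composing with `writeOn` would contradict incomparability. -/
theorem exists_apply_zero_ne {e i m : ℕ} {y : ℕ → ℕ} (hi : i < 2) (hy : IsCondition y m)
    (hcomp : ∀ f ∈ blockClass i, ∀ c, tape i y m = initSeg f c →
      ∃ h ∈ oneTape, Computes e (writeOn i y m c f) h) :
    ∃ f ∈ blockClass i, ∃ c, tape i y m = initSeg f c ∧
      ∃ h ∈ oneTape, Computes e (writeOn i y m c f) h ∧ h 0 ≠ 1 - i := by
  by_contra! hno
  obtain ⟨g₀, hg₀, hg₀y⟩ := hy.exists_mem hi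
  obtain ⟨e', he'⟩ := exists_computes_odd_writeOn e i m (tape i y m).length y
  refine not_forall_computes_blockClass hi e' (tape i y m).length hg₀ fun g hg hgg₀ => ?_
  have hgy := hg₀y.trans hgg₀.symm
  obtain ⟨h, hh, hgh⟩ := hcomp g hg _ hgy
  exact ⟨_, odd_mem_blockClass (by omega) hh (hno g hg _ hgy h hh hgh), he' g h hgh⟩

theorem not_oneTape_reducible_twoTape : ¬ ReducibleVia learnable oneTape twoTape := by
  rintro ⟨Γ, ⟨Ψ, -, hΨ⟩, hΓ⟩
  have hid : ∀ x ∈ twoTape, ∃ e, (∃ N, ∀ n, N ≤ n → Ψ (initSeg x n) = e) ∧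
      ∃ h ∈ oneTape, Computes e x h := by
    intro x hx
    obtain ⟨h, hh, hhQ⟩ := hΓ x hx
    obtain ⟨e, hN, h', hh', hc⟩ := hΨ x (Part.dom_iff_mem.2 ⟨h, hh⟩)
    exact ⟨e, hN, h', Part.mem_unique hh hh' ▸ hhQ, hc⟩
  obtain ⟨x, m, hx, hlock⟩ := exists_locks fun x hx => let ⟨e, hN, _⟩ := hid x hx; ⟨e, hN⟩
  have hcomp : ∀ y m', IsCondition y m' → m ≤ m' → (∀ n < 2 * m, y n = x n) →
      ∀ i < 2, ∀ f ∈ blockClass i, ∀ c, tape i y m' = initSeg f c →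
        ∃ h ∈ oneTape, Computes (Ψ (initSeg x (2 * m))) (writeOn i y m' c f) h := by
    intro y m' hy hm hyx i hi f hf c hfy
    obtain ⟨e, ⟨N, hN⟩, h⟩ := hid _ (hy.mem_twoTape hi hf hfy)
    have h1 := hlock y m' hy hm hyx i hi f hf c hfy (max N (2 * m)) (le_max_right _ _)
    rw [hN _ (le_max_left _ _)] at h1
    exact h1 ▸ h
  -- Continuing on tape 0 forces the locked functional to declare tape 0 at some point.
  obtain ⟨f, hf, c, hfx, h, hh, hc, h0⟩ := exists_apply_zero_ne (by norm_num) hx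
    (hcomp x m hx le_rfl (fun _ _ => rfl) 0 (by norm_num))
  have h0' : h 0 = 0 := by have := hh.1.1 0; omega
  obtain ⟨s, hs⟩ := (mem_turingFunctional_iff _ _ _ _).1 (hc 0)
  -- The new condition preserves the `s` oracle values used for that declaration, so continuing on
  -- tape 1 cannot undo it.
  obtain ⟨m', hm', hy⟩ := hx.exists_extension (by norm_num) hf hfx s
  obtain ⟨f', hf', c', hfy, h', hh', hc', h0''⟩ := exists_apply_zero_ne (by norm_num) hy
    (hcomp _ m' hy (by omega) (fun n hn => writeOn_of_lt hn) 1 (by norm_num))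
  refine h0'' (Part.mem_unique (hc' 0) ((mem_turingFunctional_iff _ _ _ _).2 ⟨s, ?_⟩))
  rw [initSeg_congr fun n hn => writeOn_of_lt (by omega), hs, h0']

theorem mainTheorem11 :
    (∃ P Q : Set (ℕ → ℕ), IsPi01Cantor P ∧ IsPi01Cantor Q ∧
      EquivVia finitelyComputable P Q ∧ ¬ ReducibleVia learnable Q P) ∧
    (∃ P Q : Set (ℕ → ℕ), IsPi01Cantor P ∧ IsPi01Cantor Q ∧
      EquivVia teamLearnable P Q ∧ StrictlyBelowVia learnable P Q) := by
  have hequiv : EquivVia finitelyComputable twoTape oneTape :=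
    ⟨twoTape_reducible_oneTape.1, oneTape_reducible_twoTape⟩
  exact ⟨⟨twoTape, oneTape, isPi01Cantor_twoTape, isPi01Cantor_oneTape, hequiv,
      not_oneTape_reducible_twoTape⟩,
    ⟨twoTape, oneTape, isPi01Cantor_twoTape, isPi01Cantor_oneTape,
      ⟨hequiv.1.mono finitelyComputable_subset_teamLearnable,
        hequiv.2.mono finitelyComputable_subset_teamLearnable⟩,
      twoTape_reducible_oneTape.2, not_oneTape_reducible_twoTape⟩⟩
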